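/- **Conventions.** Let $\mathbb{H}$ be the quaternions with units $\mathbb{i},\mathbb{j},\mathbb{k}$. Let $\mathfrak{s}$ be the real $\mathbb{Z}/2$-graded vector space with even part spanned by $\mathsf{J}(\omega),\mathsf{B}(\beta),\mathsf{P}(\pi),H$ ($\omega,\beta,\pi\in\operatorname{Im}\mathbb{H}$) and odd part $\{\mathsf{Q}(s): s\in\mathbb{H}\}$; it has dimension $10+4$. In the aristotelian case the generators $\mathsf{B}(\beta)$ are absent. All the brackets below are extended bilinearly and super-skew-symmetrically, $[\mathsf{Q},\mathsf{Q}]$ by polarisation, and brackets not listed vanish. In all cases, for $X\in\{\mathsf{J},\mathsf{B},\mathsf{P}\}$, $$[\mathsf{J}(\omega),X(\alpha)]=\tfrac12X(\omega\alpha-\alpha\omega),\qquad [\mathsf{J}(\omega),H]=0,\qquad [\mathsf{J}(\omega),\mathsf{Q}(s)]=\tfrac12\mathsf{Q}(\omega s).$$ The other brackets of odd elements are, for some $h,b,p\in\mathbb{H}$, $$[H,\mathsf{Q}(s)]=\mathsf{Q}(sh),\qquad [\mathsf{B}(\beta),\mathsf{Q}(s)]=\mathsf{Q}(\beta sb),\qquad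 [\mathsf{P}(\pi),\mathsf{Q}(s)]=\mathsf{Q}(\pi sp),$$ together with the listed $[\mathsf{Q}(s),\mathsf{Q}(s)]$. For the remaining even brackets, $[H,\mathbf{B}]=a\mathbf{B}+c\mathbf{P}$ means $[H,\mathsf{B}(\beta)]=a\mathsf{B}(\beta)+c\mathsf{P}(\beta)$ (similarly for $[H,\mathbf{P}]$), $[\mathbf{B},\mathbf{P}]=H$ means $[\mathsf{B}(\beta),\mathsf{P}(\pi)]=-\operatorname{Re}(\beta\pi)H$, and $[\mathbf{X},\mathbf{X}]=\mathbf{Y}$ means $[X(\alpha),X(\alpha')]=\tfrac12Y(\alpha\alpha'-\alpha'\alpha)$. The even brackets other than those with $\mathsf{J}$ are: - K1: none. K2: $[H,\mathbf{B}]=-\mathbf{P}$. K3$_\gamma$: $[H,\mathbf{B}]=\gamma\mathbf{B}$, $[H,\mathbf{P}]=\mathbf{P}$. K4$_\chi$: $[H,\mathbf{B}]=\chi\mathbf{B}+\mathbf{P}$, $[H,\mathbf{P}]=\chi\mathbf{P}-\mathbf{B}$. K5: $[H,\mathbf{B}]=\mathbf{B}+\mathbf{P}$, $[H,\mathbf{P}]=\mathbf{P}$.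 K6: $[\mathbf{B},\mathbf{P}]=H$. - K8: $[H,\mathbf{B}]=-\mathbf{P}$, $[\mathbf{B},\mathbf{P}]=H$, $[\mathbf{B},\mathbf{B}]=-\mathbf{J}$. K11: $[H,\mathbf{B}]=-\mathbf{P}$, $[H,\mathbf{P}]=\mathbf{B}$, $[\mathbf{B},\mathbf{P}]=H$, $[\mathbf{B},\mathbf{B}]=-\mathbf{J}$, $[\mathbf{P},\mathbf{P}]=-\mathbf{J}$. - K12: $[\mathbf{B},\mathbf{B}]=\mathbf{B}$, $[\mathbf{P},\mathbf{P}]=\mathbf{B}-\mathbf{J}$. K13: $[\mathbf{B},\mathbf{B}]=\mathbf{B}$, $[\mathbf{P},\mathbf{P}]=\mathbf{J}-\mathbf{B}$. K14: $[\mathbf{B},\mathbf{B}]=\mathbf{B}$. K15: $[\mathbf{B},\mathbf{B}]=\mathbf{P}$. K16: $[H,\mathbf{P}]=\mathbf{P}$, $[\mathbf{B},\mathbf{B}]=\mathbf{B}$. K17: $[H,\mathbf{B}]=-\mathbf{P}$, $[\mathbf{B},\mathbf{B}]=\mathbf{P}$. K18: $[H,\mathbf{B}]=\mathbf{B}$,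 $[H,\mathbf{P}]=2\mathbf{P}$, $[\mathbf{B},\mathbf{B}]=\mathbf{P}$. - (no $\mathbf{B}$) A1: none. A2: $[H,\mathbf{P}]=\mathbf{P}$. A3$_\pm$: $[\mathbf{P},\mathbf{P}]=\pm\mathbf{J}$. The superalgebras S1–S43 are the following; $h,b,p$ are zero where not given, $\lambda\in\mathbb{R}$, and $N=|s|^2H$, $J_q=\mathsf{J}(sq\bar s)$, $B_q=\mathsf{B}(sq\bar s)$, $P_q=\mathsf{P}(sq\bar s)$. | S | even part | $h,b,p$ | $[\mathsf{Q}(s),\mathsf{Q}(s)]$ | |---|---|---|---| | 1 | K1 | $h=\frac12\mathbb{k}$ | $-P_{\mathbb{k}}$ | | 2 | K1 | | $N-B_{\mathbb{j}}-P_{\mathbb{k}}$ | | 3 | K1 | | $N-P_{\mathbb{k}}$ | | 4 | K1 | | $N$ | | 5 | K1 | | $-B_{\mathbb{j}}-P_{\mathbb{k}}$ | | 6 | K1 | | $-P_{\mathbb{k}}$ | | 7 | K2 | $h=\mathbb{k}$ | $-P_{\mathbb{k}}$ | | 8 | K2 | | $-P_{\mathbb{k}}$ | | $9_{\gamma\in[-1,1],\lambda}$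 | K3$_\gamma$ | $h=\frac12(1+\lambda\mathbb{k})$ | $-P_{\mathbb{k}}$ | | $10_{\gamma\in[-1,1),\lambda}$ | K3$_\gamma$ | $h=\frac12(\gamma+\lambda\mathbb{k})$ | $-B_{\mathbb{k}}$ | | $11_{\chi\ge0}$ | K4$_\chi$ | $h=\frac12(\chi+\mathbb{j})$ | $-B_{\mathbb{i}}-P_{\mathbb{k}}$ | | $12_\lambda$ | K5 | $h=\frac12(1+\lambda\mathbb{k})$ | $-P_{\mathbb{k}}$ | | 13 | K6 | | $N$ | | 14 | K8 | $b=\frac12\mathbb{k}$ | $N-P_{\mathbb{k}}$ | | 15 | K11 | $h=\frac12\mathbb{k},\ b=\frac12\mathbb{i},\ p=\frac12\mathbb{j}$ | $N+J_{\mathbb{k}}+B_{\mathbb{j}}-P_{\mathbb{i}}$ | | 16 | K12 | $p=\frac12\mathbb{j}$ | $J_{\mathbb{i}}-B_{\mathbb{i}}+P_{\mathbb{k}}$ | | 17 | K12 | $b=\frac12$ | $N$ | | 18 | K12 | $h=\frac12\mathbb{k},\ b=\frac12$ | $N-B_{\mathbb{k}}$ | | 19 | K13 | $h=\mathbb{k},\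 p=\frac12$ | $N-J_{\mathbb{k}}+B_{\mathbb{k}}-P_{\mathbb{k}}$ | | 20 | K13 | $p=\frac12$ | $N$ | | 21 | K13 | $b=\frac12$ | $N$ | | 22 | K13 | $h=\frac12\mathbb{k},\ b=\frac12$ | $N-B_{\mathbb{k}}$ | | 23 | K14 | $h=\mathbb{k}$ | $-P_{\mathbb{k}}$ | | 24 | K14 | | $-P_{\mathbb{k}}$ | | 25 | K14 | | $N$ | | 26 | K14 | | $N-P_{\mathbb{k}}$ | | 27 | K14 | $b=\frac12$ | $N$ | | 28 | K14 | $h=\frac12\mathbb{k},\ b=\frac12$ | $N-B_{\mathbb{k}}$ | | 29 | K15 | $h=\mathbb{k}$ | $-P_{\mathbb{k}}$ | | 30 | K15 | | $-P_{\mathbb{k}}$ | | 31 | K15 | | $N$ | | 32 | K15 | | $N-P_{\mathbb{k}}$ | | $33_\lambda$ | K16 | $h=\frac12(1+\lambda\mathbb{k})$ | $-P_{\mathbb{k}}$ | | 34 | K17 | $h=\frac12\mathbb{k}$ | $-P_{\mathbb{k}}$ | | $35_\lambda$ | K18 | $h=1+\lambda\mathbb{k}$ | $-P_{\mathbb{k}}$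 | | 36 | A1 | $h=\mathbb{k}$ | $-P_{\mathbb{k}}$ | | 37 | A1 | | $-P_{\mathbb{k}}$ | | 38 | A1 | | $N$ | | 39 | A1 | | $N-P_{\mathbb{k}}$ | | $40_\lambda$ | A2 | $h=\frac12(1+\lambda\mathbb{k})$ | $-P_{\mathbb{k}}$ | | 41 | A3$_+$ | $p=\frac12$ | $N$ | | 42 | A3$_+$ | $h=\mathbb{k},\ p=\frac12$ | $N-J_{\mathbb{k}}-P_{\mathbb{k}}$ | | 43 | A3$_-$ | $p=\frac12\mathbb{i}$ | $J_{\mathbb{j}}-P_{\mathbb{k}}$ | A *central extension* of $\mathfrak{s}$ is a short exact sequence of Lie superalgebras $0\to\mathfrak{z}\to\widehat{\mathfrak{s}}\to\mathfrak{s}\to0$ with $\mathfrak{z}$ central in $\widehat{\mathfrak{s}}$; it is *trivial* if it splits as an extension of Lie superalgebras. Two extensions of $\mathfrak{s}$ by $\mathfrak{z}$ are *equivalent* if there is an isomorphism of Lie superalgebras between their middle terms which is compatible with the maps from $\mathfrak{z}$ and to $\mathfrak{s}$. **Theorem.** Each of S1–S43 (for all the parameters shown) is a Lie superalgebra, and the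 following hold. 1. It has a nontrivial central extension if and only if it is one of S1, S4, S5, S6, S7, S8, S10$_{\gamma=0,\lambda}$ ($\lambda\in\mathbb{R}$), S11$_{\chi=0}$, S13, S23, S24, S29, S30, S34, S36, S37. Every central extension of any of the others, by any $\mathfrak{z}$, is trivial. 2. For each algebra listed in 1, one obtains a nontrivial central extension $\mathfrak{s}\oplus\mathbb{R}Z$, with $Z$ even and central, by changing exactly one bracket: - for S4, $[\mathsf{B}(\beta),\mathsf{P}(\pi)]=-\operatorname{Re}(\beta\pi)Z$; - for S13, $[\mathsf{B}(\beta),\mathsf{P}(\pi)]=-\operatorname{Re}(\beta\pi)(H+Z)$; - for all the others, $[\mathsf{Q}(s),\mathsf{Q}(s)]$ is the bracket of $\mathfrak{s}$ plus $|s|^2Z$. 3. For each algebra listed in 1, let $\omega$ be the bilinear form on $\mathfrak{s}$ for which the bracket in 2 is $[X,Y]+\omega(X,Y)Z$. Then every central extension of $\mathfrak{s}$ by any $\mathfrak{z}$ is equivalent to the extension $\mathfrak{s}\oplus\mathfrak{z}$ with bracket $[(X,z),(Y,z')]=([X,Y],\omega(X,Y)\,c)$ for exactly one even element $c\in\mathfrak{z}$.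 -/

import Mathlib

open scoped Quaternion

noncomputable section

set_option linter.unusedSimpArgs false

namespace KLSA

/-! ### Real Lie superalgebras and their central extensions -/

/-- A real vector space with two distinguished subspaces (`part 0` even, `part 1` odd)
and a bilinear bracket. -/
structure SuperAlgebra (V : Type*) [AddCommGroup V] [Module ℝ V] where
  part : ZMod 2 → Submodule ℝ V
  bracket : V →ₗ[ℝ] V →ₗ[ℝ] V

section General

variable {V : Type*} [AddCommGroup V] [Module ℝ V]
variable {W : Type*} [AddCommGroup W] [Module ℝ W]
variable {W' : Type*} [AddCommGroup W'] [Module ℝ W']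
variable {Z : Type*} [AddCommGroup Z] [Module ℝ Z]

/-- The Koszul sign `(-1)^(ij)`. -/
def koszul (i j : ZMod 2) : ℝ := (-1) ^ (i.val * j.val)

/-- `A` is a Lie superalgebra: the space is the direct sum of its even and odd parts, the bracket
is compatible with the grading, super-skew-symmetric, and satisfies the super Jacobi identity. -/
structure IsLieSuperalgebra (A : SuperAlgebra V) : Prop where
  isCompl : IsCompl (A.part 0) (A.part 1)
  bracket_mem : ∀ i j, ∀ x ∈ A.part i, ∀ y ∈ A.part j, A.bracket x y ∈ A.part (i + j)
  skew : ∀ i j, ∀ x ∈ A.part i, ∀ y ∈ A.part j,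
    A.bracket x y = -(koszul i j • A.bracket y x)
  jacobi : ∀ i j, ∀ x ∈ A.part i, ∀ y ∈ A.part j, ∀ z,
    A.bracket x (A.bracket y z)
      = A.bracket (A.bracket x y) z + koszul i j • A.bracket y (A.bracket x z)

/-- Homomorphisms: linear maps which preserve parity and the bracket. -/
structure IsHom (A : SuperAlgebra V) (B : SuperAlgebra W) (f : V →ₗ[ℝ] W) : Prop where
  map_part : ∀ i, ∀ x ∈ A.part i, f x ∈ B.part i
  map_bracket : ∀ x y, f (A.bracket x y) = B.bracket (f x) (f y)

/-- `0 → C → E → A → 0` (with maps `ι` and `π`) is a short exact sequence of Lie superalgebras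
in which the image of `C` is central in `E`. -/
structure IsCentralExtension (C : SuperAlgebra Z) (E : SuperAlgebra W) (A : SuperAlgebra V)
    (ι : Z →ₗ[ℝ] W) (π : W →ₗ[ℝ] V) : Prop where
  lie_left : IsLieSuperalgebra C
  lie_mid : IsLieSuperalgebra E
  lie_right : IsLieSuperalgebra A
  hom_left : IsHom C E ι
  hom_right : IsHom E A π
  injective : Function.Injective ι
  surjective : Function.Surjective π
  exact : LinearMap.range ι = LinearMap.ker π
  central : ∀ z w, E.bracket (ι z) w = 0

/-- A central extension `π : E → A` is trivial if it splits as an extension of Lie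
superalgebras. -/
def Splits (E : SuperAlgebra W) (A : SuperAlgebra V) (π : W →ₗ[ℝ] V) : Prop :=
  ∃ σ : V →ₗ[ℝ] W, IsHom A E σ ∧ π ∘ₗ σ = LinearMap.id

/-- Equivalence of two extensions of the same algebra by the same kernel: an isomorphism of Lie
superalgebras which is compatible with the inclusions of the kernel and with the projections. -/
def Equivalent (E : SuperAlgebra W) (ι : Z →ₗ[ℝ] W) (π : W →ₗ[ℝ] V)
    (E' : SuperAlgebra W') (ι' : Z →ₗ[ℝ] W') (π' : W' →ₗ[ℝ] V) : Prop :=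
  ∃ φ : W ≃ₗ[ℝ] W', IsHom E E' φ.toLinearMap ∧ IsHom E' E φ.symm.toLinearMap ∧
    φ.toLinearMap ∘ₗ ι = ι' ∧ π' ∘ₗ φ.toLinearMap = π

/-- The superalgebra `A ⊕ C` with bracket `[(X, z), (Y, z')] = ([X, Y], ω(X, Y) c)`. -/
def extendBy (A : SuperAlgebra V) (ω : V →ₗ[ℝ] V →ₗ[ℝ] ℝ) (C : SuperAlgebra Z) (c : Z) :
    SuperAlgebra (V × Z) where
  part i := (A.part i).prod (C.part i)
  bracket := LinearMap.mk₂ ℝ (fun X Y => (A.bracket X.1 Y.1, ω X.1 Y.1 • c))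
    (by intros; simp [add_smul]) (by intros; simp [mul_smul])
    (by intros; simp [add_smul]) (by intros; simp [mul_smul])

/-- The one-dimensional abelian Lie superalgebra `ℝ Z`, with `Z = 1` even. -/
def line : SuperAlgebra ℝ where
  part i := if i = 0 then ⊤ else ⊥
  bracket := 0

/-- `A` has a nontrivial central extension. -/
def AdmitsNontrivialCentralExtension (A : SuperAlgebra V) : Prop :=
  ∃ (Z : Type) (_ : AddCommGroup Z) (_ : Module ℝ Z) (W : Type) (_ : AddCommGroup W)
    (_ : Module ℝ W) (C : SuperAlgebra Z) (E : SuperAlgebra W) (ι : Z →ₗ[ℝ] W) (π : W →ₗ[ℝ] V),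
    IsCentralExtension C E A ι π ∧ ¬ Splits E A π

/-- Every central extension of `A` (by any central kernel) is trivial. -/
def OnlyTrivialCentralExtensions.{u, v} {V : Type} [AddCommGroup V] [Module ℝ V]
    (A : SuperAlgebra V) : Prop :=
  ∀ (Z : Type u) [AddCommGroup Z] [Module ℝ Z] (W : Type v) [AddCommGroup W] [Module ℝ W]
    (C : SuperAlgebra Z) (E : SuperAlgebra W) (ι : Z →ₗ[ℝ] W) (π : W →ₗ[ℝ] V),
    IsCentralExtension C E A ι π → Splits E A π

/-- The cocycle `ω` gives all central extensions of `A`: each central extension of `A` (by any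
central kernel `C`) is equivalent to the one with bracket `[X, Y] + ω(X, Y) c`, for exactly one
even element `c` of `C`. -/
def CentralExtensionsGivenBy.{u, v} {V : Type} [AddCommGroup V] [Module ℝ V]
    (A : SuperAlgebra V) (ω : V →ₗ[ℝ] V →ₗ[ℝ] ℝ) : Prop :=
  ∀ (Z : Type u) [AddCommGroup Z] [Module ℝ Z] (W : Type v) [AddCommGroup W] [Module ℝ W]
    (C : SuperAlgebra Z) (E : SuperAlgebra W) (ι : Z →ₗ[ℝ] W) (π : W →ₗ[ℝ] V),
    IsCentralExtension C E A ι π →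
      ∃! c : Z, c ∈ C.part 0 ∧
        Equivalent E ι π (extendBy A ω C c) (LinearMap.inr ℝ V Z) (LinearMap.fst ℝ V Z)

end General

/-! ### Vectors and quaternions -/

/-- The imaginary quaternions, in the basis `i, j, k`. -/
abbrev V3 := Fin 3 → ℝ

def qi : ℍ[ℝ] := ⟨0, 1, 0, 0⟩
def qj : ℍ[ℝ] := ⟨0, 0, 1, 0⟩
def qk : ℍ[ℝ] := ⟨0, 0, 0, 1⟩

@[simp] theorem qi_re : qi.re = 0 := rfl
@[simp] theorem qi_imI : qi.imI = 1 := rfl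
@[simp] theorem qi_imJ : qi.imJ = 0 := rfl
@[simp] theorem qi_imK : qi.imK = 0 := rfl
@[simp] theorem qj_re : qj.re = 0 := rfl
@[simp] theorem qj_imI : qj.imI = 0 := rfl
@[simp] theorem qj_imJ : qj.imJ = 1 := rfl
@[simp] theorem qj_imK : qj.imK = 0 := rfl
@[simp] theorem qk_re : qk.re = 0 := rfl
@[simp] theorem qk_imI : qk.imI = 0 := rfl
@[simp] theorem qk_imJ : qk.imJ = 0 := rfl
@[simp] theorem qk_imK : qk.imK = 1 := rfl

/-- The inclusion of the imaginary quaternions into the quaternions. -/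
def toH : V3 →ₗ[ℝ] ℍ[ℝ] where
  toFun v := ⟨0, v 0, v 1, v 2⟩
  map_add' _ _ := Quaternion.ext _ _ (add_zero 0).symm rfl rfl rfl
  map_smul' r _ := Quaternion.ext _ _ (mul_zero r).symm rfl rfl rfl

/-- The imaginary part of a quaternion. -/
def vec : ℍ[ℝ] →ₗ[ℝ] V3 where
  toFun q := ![q.imI, q.imJ, q.imK]
  map_add' _ _ := by ext i; fin_cases i <;> simp
  map_smul' _ _ := by ext i; fin_cases i <;> simp

@[simp] theorem toH_re (v : V3) : (toH v).re = 0 := rfl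
@[simp] theorem toH_imI (v : V3) : (toH v).imI = v 0 := rfl
@[simp] theorem toH_imJ (v : V3) : (toH v).imJ = v 1 := rfl
@[simp] theorem toH_imK (v : V3) : (toH v).imK = v 2 := rfl
@[simp] theorem vec_zero (q : ℍ[ℝ]) : vec q 0 = q.imI := rfl
@[simp] theorem vec_one (q : ℍ[ℝ]) : vec q 1 = q.imJ := rfl
@[simp] theorem vec_two (q : ℍ[ℝ]) : vec q 2 = q.imK := rfl

/-- The commutator bracket `½ (u v - v u)` of imaginary quaternions (the cross product), which is
the abbreviated `[𝐀, 𝐀'] = 𝐀''`, that is `[A_i, A'_j] = ε_{ijk} A''_k`. -/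
def cr (u v : V3) : V3 := vec ((1 / 2 : ℝ) • (toH u * toH v - toH v * toH u))

/-- The real number `-Re(u v)`, that is the scalar product `∑ u_i v_i`. -/
def dt (u v : V3) : ℝ := -(toH u * toH v).re

/-- The polarisation `½ (s' c s̄ + s c s̄')` of `s c s̄`, for `c` imaginary. -/
def pol (c s s' : ℍ[ℝ]) : V3 := vec ((1 / 2 : ℝ) • (s' * c * star s + s * c * star s'))

/-- The polarisation `Re(s̄ s')` of `|s|²`. -/
def nrm (s s' : ℍ[ℝ]) : ℝ := (star s * s').re

/-! ### Kinematical superalgebras -/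

/-- `((ω, β, π, t), s)` stands for `J(ω) + B(β) + P(π) + t H + Q(s)`. -/
abbrev KinSpace := (V3 × V3 × V3 × ℝ) × ℍ[ℝ]

/-- Coefficients of the brackets of a kinematical Lie algebra: `XY_U` is the coefficient of `U`
in the bracket `[X, Y]`; those not listed vanish. -/
structure KinEven where
  HB_B : ℝ := 0
  HB_P : ℝ := 0
  HP_B : ℝ := 0
  HP_P : ℝ := 0
  BP_H : ℝ := 0
  BB_J : ℝ := 0
  BB_B : ℝ := 0
  BB_P : ℝ := 0
  PP_J : ℝ := 0
  PP_B : ℝ := 0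

def K1 : KinEven := {}
def K2 : KinEven := { HB_P := -1 }
def K3 (γ : ℝ) : KinEven := { HB_B := γ, HP_P := 1 }
def K4 (χ : ℝ) : KinEven := { HB_B := χ, HB_P := 1, HP_P := χ, HP_B := -1 }
def K5 : KinEven := { HB_B := 1, HB_P := 1, HP_P := 1 }
def K6 : KinEven := { BP_H := 1 }
def K8 : KinEven := { HB_P := -1, BP_H := 1, BB_J := -1 }
def K11 : KinEven := { HB_P := -1, HP_B := 1, BP_H := 1, BB_J := -1, PP_J := -1 }
def K12 : KinEven := { BB_B := 1, PP_B := 1, PP_J := -1 }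
def K13 : KinEven := { BB_B := 1, PP_J := 1, PP_B := -1 }
def K14 : KinEven := { BB_B := 1 }
def K15 : KinEven := { BB_P := 1 }
def K16 : KinEven := { HP_P := 1, BB_B := 1 }
def K17 : KinEven := { HB_P := -1, BB_P := 1 }
def K18 : KinEven := { HB_B := 1, HP_P := 2, BB_P := 1 }

/-- The remaining brackets: `[H, Q(s)] = Q(s h)`, `[B(β), Q(s)] = Q(β s b)`,
`[P(π), Q(s)] = Q(π s p)` and
`[Q(s), Q(s)] = c₀ |s|² H - J(s c₁ s̄) - B(s c₂ s̄) - P(s c₃ s̄)`. -/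
structure KinData where
  even : KinEven
  h : ℍ[ℝ] := 0
  b : ℍ[ℝ] := 0
  p : ℍ[ℝ] := 0
  c0 : ℝ := 0
  c1 : ℍ[ℝ] := 0
  c2 : ℍ[ℝ] := 0
  c3 : ℍ[ℝ] := 0

/-- The bracket of `J(ω) + B(β) + P(π) + t H + Q(s)` and
`J(ω') + B(β') + P(π') + t' H + Q(s')`. -/
def kinBracketFun (D : KinData) : KinSpace → KinSpace → KinSpace
  | ((ω, β, π, t), s), ((ω', β', π', t'), s') =>
    ((cr ω ω' + D.even.BB_J • cr β β' + D.even.PP_J • cr π π' - pol D.c1 s s',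
      cr ω β' + cr β ω' + D.even.HB_B • (t • β' - t' • β) + D.even.HP_B • (t • π' - t' • π)
        + D.even.BB_B • cr β β' + D.even.PP_B • cr π π' - pol D.c2 s s',
      cr ω π' + cr π ω' + D.even.HB_P • (t • β' - t' • β) + D.even.HP_P • (t • π' - t' • π)
        + D.even.BB_P • cr β β' - pol D.c3 s s',
      D.even.BP_H * (dt β π' - dt β' π) + D.c0 * nrm s s'),
     (1 / 2 : ℝ) • (toH ω * s' - toH ω' * s)
       + (t • (s' * D.h) - t' • (s * D.h))
       + (toH β * s' * D.b - toH β' * s * D.b)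
       + (toH π * s' * D.p - toH π' * s * D.p))

theorem kinBracketFun_add_left (D : KinData) (X Y U : KinSpace) :
    kinBracketFun D (X + Y) U = kinBracketFun D X U + kinBracketFun D Y U := by
  obtain ⟨⟨a1, a2, a3, a4⟩, a5⟩ := X
  obtain ⟨⟨b1, b2, b3, b4⟩, b5⟩ := Y
  obtain ⟨⟨d1, d2, d3, d4⟩, d5⟩ := U
  simp only [kinBracketFun, Prod.mk_add_mk, cr, pol, dt, nrm, map_add, star_add, add_mul, mul_add,
    Quaternion.re_add, ← map_smul, smul_sub, smul_add, add_smul, map_sub, mul_sub]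
  congr 1
  · congr 1
    · module
    · congr 1
      · module
      · congr 1
        · module
        · ring
  · module

theorem kinBracketFun_smul_left (D : KinData) (r : ℝ) (X U : KinSpace) :
    kinBracketFun D (r • X) U = r • kinBracketFun D X U := by
  obtain ⟨⟨a1, a2, a3, a4⟩, a5⟩ := X
  obtain ⟨⟨d1, d2, d3, d4⟩, d5⟩ := U
  simp only [kinBracketFun, Prod.smul_mk, cr, pol, dt, nrm, map_smul, Quaternion.star_smul,
    smul_mul_assoc, mul_smul_comm, Quaternion.re_smul, map_sub, map_add, smul_eq_mul]
  congr 1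
  · congr 1
    · module
    · congr 1
      · module
      · congr 1
        · module
        · ring
  · module

theorem kinBracketFun_add_right (D : KinData) (U X Y : KinSpace) :
    kinBracketFun D U (X + Y) = kinBracketFun D U X + kinBracketFun D U Y := by
  obtain ⟨⟨a1, a2, a3, a4⟩, a5⟩ := X
  obtain ⟨⟨b1, b2, b3, b4⟩, b5⟩ := Y
  obtain ⟨⟨d1, d2, d3, d4⟩, d5⟩ := U
  simp only [kinBracketFun, Prod.mk_add_mk, cr, pol, dt, nrm, map_add, star_add, add_mul, mul_add,
    Quaternion.re_add, ← map_smul, smul_sub, smul_add, add_smul, map_sub, mul_sub]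
  congr 1
  · congr 1
    · module
    · congr 1
      · module
      · congr 1
        · module
        · ring
  · module

theorem kinBracketFun_smul_right (D : KinData) (r : ℝ) (U X : KinSpace) :
    kinBracketFun D U (r • X) = r • kinBracketFun D U X := by
  obtain ⟨⟨a1, a2, a3, a4⟩, a5⟩ := X
  obtain ⟨⟨d1, d2, d3, d4⟩, d5⟩ := U
  simp only [kinBracketFun, Prod.smul_mk, cr, pol, dt, nrm, map_smul, Quaternion.star_smul,
    smul_mul_assoc, mul_smul_comm, Quaternion.re_smul, map_sub, map_add, smul_eq_mul]
  congr 1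
  · congr 1
    · module
    · congr 1
      · module
      · congr 1
        · module
        · ring
  · module

/-- The superalgebra with the given brackets: `J, B, P, H` are even and `Q` is odd. -/
def kinAlgebra (D : KinData) : SuperAlgebra KinSpace where
  part i := if i = 0 then LinearMap.ker (LinearMap.snd ℝ (V3 × V3 × V3 × ℝ) ℍ[ℝ])
    else LinearMap.ker (LinearMap.fst ℝ (V3 × V3 × V3 × ℝ) ℍ[ℝ])
  bracket := LinearMap.mk₂ ℝ (kinBracketFun D) (kinBracketFun_add_left D)
    (kinBracketFun_smul_left D) (kinBracketFun_add_right D) (kinBracketFun_smul_right D)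

/-- The labels of the kinematical Lie superalgebras S1-S35, with their parameters. -/
inductive KinLabel
  | S1 | S2 | S3 | S4 | S5 | S6 | S7 | S8
  | S9 (γ l : ℝ) (hγ : γ ∈ Set.Icc (-1 : ℝ) 1)
  | S10 (γ l : ℝ) (hγ : γ ∈ Set.Ico (-1 : ℝ) 1)
  | S11 (χ : ℝ) (hχ : 0 ≤ χ)
  | S12 (l : ℝ)
  | S13 | S14 | S15 | S16 | S17 | S18 | S19 | S20 | S21 | S22 | S23 | S24 | S25 | S26 | S27 | S28
  | S29 | S30 | S31 | S32
  | S33 (l : ℝ)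
  | S34
  | S35 (l : ℝ)

/-- The table of kinematical Lie superalgebras. -/
def KinLabel.data : KinLabel → KinData
  | S1 => { even := K1, h := (1 / 2 : ℝ) • qk, c3 := qk }
  | S2 => { even := K1, c0 := 1, c2 := qj, c3 := qk }
  | S3 => { even := K1, c0 := 1, c3 := qk }
  | S4 => { even := K1, c0 := 1 }
  | S5 => { even := K1, c2 := qj, c3 := qk }
  | S6 => { even := K1, c3 := qk }
  | S7 => { even := K2, h := qk, c3 := qk }
  | S8 => { even := K2, c3 := qk }
  | S9 γ l _ => { even := K3 γ, h := (1 / 2 : ℝ) • (1 + l • qk), c3 := qk }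
  | S10 γ l _ => { even := K3 γ, h := (1 / 2 : ℝ) • ((γ : ℍ[ℝ]) + l • qk), c2 := qk }
  | S11 χ _ => { even := K4 χ, h := (1 / 2 : ℝ) • ((χ : ℍ[ℝ]) + qj), c2 := qi, c3 := qk }
  | S12 l => { even := K5, h := (1 / 2 : ℝ) • (1 + l • qk), c3 := qk }
  | S13 => { even := K6, c0 := 1 }
  | S14 => { even := K8, b := (1 / 2 : ℝ) • qk, c0 := 1, c3 := qk }
  | S15 => { even := K11, h := (1 / 2 : ℝ) • qk, b := (1 / 2 : ℝ) • qi, p := (1 / 2 : ℝ) • qj,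
             c0 := 1, c1 := -qk, c2 := -qj, c3 := qi }
  | S16 => { even := K12, p := (1 / 2 : ℝ) • qj, c1 := -qi, c2 := qi, c3 := -qk }
  | S17 => { even := K12, b := (1 / 2 : ℝ) • 1, c0 := 1 }
  | S18 => { even := K12, h := (1 / 2 : ℝ) • qk, b := (1 / 2 : ℝ) • 1, c0 := 1, c2 := qk }
  | S19 => { even := K13, h := qk, p := (1 / 2 : ℝ) • 1, c0 := 1, c1 := qk, c2 := -qk, c3 := qk }
  | S20 => { even := K13, p := (1 / 2 : ℝ) • 1, c0 := 1 }
  | S21 => { even := K13, b := (1 / 2 : ℝ) • 1, c0 := 1 }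
  | S22 => { even := K13, h := (1 / 2 : ℝ) • qk, b := (1 / 2 : ℝ) • 1, c0 := 1, c2 := qk }
  | S23 => { even := K14, h := qk, c3 := qk }
  | S24 => { even := K14, c3 := qk }
  | S25 => { even := K14, c0 := 1 }
  | S26 => { even := K14, c0 := 1, c3 := qk }
  | S27 => { even := K14, b := (1 / 2 : ℝ) • 1, c0 := 1 }
  | S28 => { even := K14, h := (1 / 2 : ℝ) • qk, b := (1 / 2 : ℝ) • 1, c0 := 1, c2 := qk }
  | S29 => { even := K15, h := qk, c3 := qk }
  | S30 => { even := K15, c3 := qk }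
  | S31 => { even := K15, c0 := 1 }
  | S32 => { even := K15, c0 := 1, c3 := qk }
  | S33 l => { even := K16, h := (1 / 2 : ℝ) • (1 + l • qk), c3 := qk }
  | S34 => { even := K17, h := (1 / 2 : ℝ) • qk, c3 := qk }
  | S35 l => { even := K18, h := 1 + l • qk, c3 := qk }

def KinLabel.algebra (L : KinLabel) : SuperAlgebra KinSpace := kinAlgebra L.data

/-- The cochain whose only nonzero values on generators are
`ω(B(β), P(π)) = -x Re(β π) = -ω(P(π), B(β))` and `ω(Q(s), Q(s')) = y Re(s̄ s')`. -/
def kinCochain (x y : ℝ) : KinSpace →ₗ[ℝ] KinSpace →ₗ[ℝ] ℝ :=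
  LinearMap.mk₂ ℝ
    (fun X Y => x * (dt X.1.2.1 Y.1.2.2.1 - dt Y.1.2.1 X.1.2.2.1) + y * nrm X.2 Y.2)
    (by intros; simp only [dt, nrm, Prod.fst_add, Prod.snd_add, map_add, star_add, add_mul,
          mul_add, Quaternion.re_add]; ring)
    (by intros; simp only [dt, nrm, Prod.smul_fst, Prod.smul_snd, map_smul, Quaternion.star_smul, smul_mul_assoc, mul_smul_comm, Quaternion.re_smul, smul_eq_mul]; ring)
    (by intros; simp only [dt, nrm, Prod.fst_add, Prod.snd_add, map_add, star_add, add_mul,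
          mul_add, Quaternion.re_add]; ring)
    (by intros; simp only [dt, nrm, Prod.smul_fst, Prod.smul_snd, map_smul, Quaternion.star_smul, smul_mul_assoc, mul_smul_comm, Quaternion.re_smul, smul_eq_mul]; ring)

/-- The table of central terms: `KinRow L x y` says that `L` is listed, with `-x Re(β π) Z` added
to the bracket `[B(β), P(π)]` and `y |s|² Z` added to the bracket `[Q(s), Q(s)]`. -/
inductive KinRow : KinLabel → ℝ → ℝ → Prop
  | S1 : KinRow .S1 0 1
  | S4 : KinRow .S4 1 0
  | S5 : KinRow .S5 0 1
  | S6 : KinRow .S6 0 1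
  | S7 : KinRow .S7 0 1
  | S8 : KinRow .S8 0 1
  | S10 (γ l : ℝ) (hγ : γ ∈ Set.Ico (-1 : ℝ) 1) : γ = 0 → KinRow (.S10 γ l hγ) 0 1
  | S11 (χ : ℝ) (hχ : 0 ≤ χ) : χ = 0 → KinRow (.S11 χ hχ) 0 1
  | S13 : KinRow .S13 1 0
  | S23 : KinRow .S23 0 1
  | S24 : KinRow .S24 0 1
  | S29 : KinRow .S29 0 1
  | S30 : KinRow .S30 0 1
  | S34 : KinRow .S34 0 1

/-! ### Aristotelian superalgebras -/

/-- `((ω, π, t), s)` stands for `J(ω) + P(π) + t H + Q(s)`. -/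
abbrev AriSpace := (V3 × V3 × ℝ) × ℍ[ℝ]

/-- The brackets `[H, 𝐏] = HP_P 𝐏`, `[𝐏, 𝐏] = PP_J 𝐉`, `[H, Q(s)] = Q(s h)`,
`[P(π), Q(s)] = Q(π s p)` and `[Q(s), Q(s)] = c₀ |s|² H - J(s c₁ s̄) - P(s c₃ s̄)`. -/
structure AriData where
  HP_P : ℝ := 0
  PP_J : ℝ := 0
  h : ℍ[ℝ] := 0
  p : ℍ[ℝ] := 0
  c0 : ℝ := 0
  c1 : ℍ[ℝ] := 0
  c3 : ℍ[ℝ] := 0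

/-- The bracket of `J(ω) + P(π) + t H + Q(s)` and `J(ω') + P(π') + t' H + Q(s')`. -/
def ariBracketFun (D : AriData) : AriSpace → AriSpace → AriSpace
  | ((ω, π, t), s), ((ω', π', t'), s') =>
    ((cr ω ω' + D.PP_J • cr π π' - pol D.c1 s s',
      cr ω π' + cr π ω' + D.HP_P • (t • π' - t' • π) - pol D.c3 s s',
      D.c0 * nrm s s'),
     (1 / 2 : ℝ) • (toH ω * s' - toH ω' * s)
       + (t • (s' * D.h) - t' • (s * D.h))
       + (toH π * s' * D.p - toH π' * s * D.p))

theorem ariBracketFun_add_left (D : AriData) (X Y U : AriSpace) :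
    ariBracketFun D (X + Y) U = ariBracketFun D X U + ariBracketFun D Y U := by
  obtain ⟨⟨a1, a3, a4⟩, a5⟩ := X
  obtain ⟨⟨b1, b3, b4⟩, b5⟩ := Y
  obtain ⟨⟨d1, d3, d4⟩, d5⟩ := U
  simp only [ariBracketFun, Prod.mk_add_mk, cr, pol, dt, nrm, map_add, star_add, add_mul, mul_add,
    Quaternion.re_add, ← map_smul, smul_sub, smul_add, add_smul, map_sub, mul_sub]
  congr 1
  · congr 1
    · module
    · congr 1
      · module
  · module

theorem ariBracketFun_smul_left (D : AriData) (r : ℝ) (X U : AriSpace) :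
    ariBracketFun D (r • X) U = r • ariBracketFun D X U := by
  obtain ⟨⟨a1, a3, a4⟩, a5⟩ := X
  obtain ⟨⟨d1, d3, d4⟩, d5⟩ := U
  simp only [ariBracketFun, Prod.smul_mk, cr, pol, dt, nrm, map_smul, Quaternion.star_smul,
    smul_mul_assoc, mul_smul_comm, Quaternion.re_smul, map_sub, map_add, smul_eq_mul]
  congr 1
  · congr 1
    · module
    · congr 1
      · module
      · ring
  · module

theorem ariBracketFun_add_right (D : AriData) (U X Y : AriSpace) :
    ariBracketFun D U (X + Y) = ariBracketFun D U X + ariBracketFun D U Y := by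
  obtain ⟨⟨a1, a3, a4⟩, a5⟩ := X
  obtain ⟨⟨b1, b3, b4⟩, b5⟩ := Y
  obtain ⟨⟨d1, d3, d4⟩, d5⟩ := U
  simp only [ariBracketFun, Prod.mk_add_mk, cr, pol, dt, nrm, map_add, star_add, add_mul, mul_add,
    Quaternion.re_add, ← map_smul, smul_sub, smul_add, add_smul, map_sub, mul_sub]
  congr 1
  · congr 1
    · module
    · congr 1
      · module
  · module

theorem ariBracketFun_smul_right (D : AriData) (r : ℝ) (U X : AriSpace) :
    ariBracketFun D U (r • X) = r • ariBracketFun D U X := by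
  obtain ⟨⟨a1, a3, a4⟩, a5⟩ := X
  obtain ⟨⟨d1, d3, d4⟩, d5⟩ := U
  simp only [ariBracketFun, Prod.smul_mk, cr, pol, dt, nrm, map_smul, Quaternion.star_smul,
    smul_mul_assoc, mul_smul_comm, Quaternion.re_smul, map_sub, map_add, smul_eq_mul]
  congr 1
  · congr 1
    · module
    · congr 1
      · module
      · ring
  · module

/-- The superalgebra with the given brackets: `J, P, H` are even and `Q` is odd. -/
def ariAlgebra (D : AriData) : SuperAlgebra AriSpace where
  part i := if i = 0 then LinearMap.ker (LinearMap.snd ℝ (V3 × V3 × ℝ) ℍ[ℝ])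
    else LinearMap.ker (LinearMap.fst ℝ (V3 × V3 × ℝ) ℍ[ℝ])
  bracket := LinearMap.mk₂ ℝ (ariBracketFun D) (ariBracketFun_add_left D)
    (ariBracketFun_smul_left D) (ariBracketFun_add_right D) (ariBracketFun_smul_right D)

/-- The labels of the aristotelian Lie superalgebras S36-S43, with their parameters. -/
inductive AriLabel
  | S36 | S37 | S38 | S39
  | S40 (l : ℝ)
  | S41 | S42 | S43

/-- The table of aristotelian Lie superalgebras. -/
def AriLabel.data : AriLabel → AriData
  | S36 => { h := qk, c3 := qk }
  | S37 => { c3 := qk }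
  | S38 => { c0 := 1 }
  | S39 => { c0 := 1, c3 := qk }
  | S40 l => { HP_P := 1, h := (1 / 2 : ℝ) • (1 + l • qk), c3 := qk }
  | S41 => { PP_J := 1, p := (1 / 2 : ℝ) • 1, c0 := 1 }
  | S42 => { PP_J := 1, h := qk, p := (1 / 2 : ℝ) • 1, c0 := 1, c1 := qk, c3 := qk }
  | S43 => { PP_J := -1, p := (1 / 2 : ℝ) • qi, c1 := -qj, c3 := qk }

def AriLabel.algebra (L : AriLabel) : SuperAlgebra AriSpace := ariAlgebra L.data

/-- The cochain whose only nonzero values on generators are `ω(Q(s), Q(s')) = y Re(s̄ s')`. -/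
def ariCochain (y : ℝ) : AriSpace →ₗ[ℝ] AriSpace →ₗ[ℝ] ℝ :=
  LinearMap.mk₂ ℝ (fun X Y => y * nrm X.2 Y.2)
    (by intros; simp only [nrm, Prod.snd_add, star_add, add_mul, mul_add, Quaternion.re_add])
    (by intros; simp only [nrm, Prod.smul_snd, Quaternion.star_smul, smul_mul_assoc,
          Quaternion.re_smul, smul_eq_mul]; ring)
    (by intros; simp only [nrm, Prod.snd_add, mul_add, Quaternion.re_add])
    (by intros; simp only [nrm, Prod.smul_snd, mul_smul_comm, Quaternion.re_smul,
          smul_eq_mul]; ring)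

/-- The table of central terms: `AriRow L y` says that `L` is listed, with `y |s|² Z` added to the
bracket `[Q(s), Q(s)]`. -/
inductive AriRow : AriLabel → ℝ → Prop
  | S36 : AriRow .S36 1
  | S37 : AriRow .S37 1

/-! ### The assertion for one listed algebra -/

/-- Adding the central terms `ω(X, Y) Z` to the brackets of `A` gives a nontrivial central
extension of `A` by the even line `ℝ Z`, and every central extension of `A` comes from it. -/
def HasCentralTerm.{u, v} {V : Type} [AddCommGroup V] [Module ℝ V] (A : SuperAlgebra V)
    (ω : V →ₗ[ℝ] V →ₗ[ℝ] ℝ) : Prop :=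
  IsCentralExtension line (extendBy A ω line 1) A (LinearMap.inr ℝ V ℝ) (LinearMap.fst ℝ V ℝ) ∧
  ¬ Splits (extendBy A ω line 1) A (LinearMap.fst ℝ V ℝ) ∧
  CentralExtensionsGivenBy.{u, v} A ω

end KLSA

end

open KLSA

universe u v

/-!
The proof computes the second cohomology of each algebra and then translates it into extensions.

A central extension of `A` by `C` has a parity-preserving linear section, and the failure of the
section to be a homomorphism is an even 2-cocycle of `A` with values in `C`; changing the section
changes the cocycle by a coboundary `θ ∘ [ , ]`. Hence everything follows from
`CocyclesSpannedBy A ω₀` (each cocycle is cohomologous to `ω₀ • c` for some even `c`), with `ω₀ = 0`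
for the algebras without nontrivial extension, together with `NonzeroOnCycle A ω₀`, a 2-cycle on
which `ω₀` does not vanish. The latter gives both nontriviality and uniqueness of `c`.

For the cohomology of a kinematical superalgebra (`cocyclesSpannedBy_kinCochain`) the rotations
`J` are used twice. The Casimir operator gives an explicit `θ` which removes all components
`ω(J, ·)` of a cocycle (`IsCocycle.exists_coboundary_J`). What remains is rotation-invariant, and
the only invariants, with any coefficients, are `x` times the scalar product on `B ⊗ P` and `y`
times the real inner product on `Q ⊗ Q` (`IsCocycle.exists_eq_of_J`). The cocycle identity becomes
a few linear equations for `(x, y)` (`IsCocycle.constraints`), and the only coboundaries left are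
those of the functional dual to `H`, which are the multiples of `(BP_H, c₀)`. The table is then a
matter of linear algebra.

The Jacobi identity is reduced to generators `J, B, P, H, Q`, and by super-skew-symmetry to triples
of sorted types. Triples with a `J` hold by equivariance; the others follow from quaternionic
equations for the structure constants (`KinData.JacobiConditions`), which are checked for each row.

An aristotelian superalgebra is a direct factor of a kinematical one whose boosts span a copy of
`so(3)` (`AriData.toKin`). Being a retract, it inherits the Jacobi identity and the description of
its cocycles.
-/

set_option linter.unusedSimpArgs false

namespace KLSA

/-! ### Cocycles and central extensions -/

section General

variable {V W Z : Type*} [AddCommGroup V] [Module ℝ V] [AddCommGroup W] [Module ℝ W]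
  [AddCommGroup Z] [Module ℝ Z]

/-- `ω` is an even 2-cocycle of `A` with values in the trivial module `C` (only the grading of `C`
matters). -/
structure IsCocycle (A : SuperAlgebra V) (C : SuperAlgebra Z) (ω : V →ₗ[ℝ] V →ₗ[ℝ] Z) : Prop where
  mem : ∀ i j, ∀ x ∈ A.part i, ∀ y ∈ A.part j, ω x y ∈ C.part (i + j)
  skew : ∀ i j, ∀ x ∈ A.part i, ∀ y ∈ A.part j, ω x y = -(koszul i j • ω y x)
  cocycle : ∀ i j, ∀ x ∈ A.part i, ∀ y ∈ A.part j, ∀ z,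
    ω x (A.bracket y z) = ω (A.bracket x y) z + koszul i j • ω y (A.bracket x z)

/-- Up to coboundaries, the even 2-cocycles of `A` with values in any `C` are the multiples of the
real cocycle `ω₀` by even elements of `C`. -/
def CocyclesSpannedBy.{uZ} {V : Type*} [AddCommGroup V] [Module ℝ V] (A : SuperAlgebra V)
    (ω₀ : V →ₗ[ℝ] V →ₗ[ℝ] ℝ) : Prop :=
  ∀ (Z : Type uZ) [AddCommGroup Z] [Module ℝ Z] (C : SuperAlgebra Z) (ω : V →ₗ[ℝ] V →ₗ[ℝ] Z),
    IsCocycle A C ω → ∃ θ : V →ₗ[ℝ] Z, (∀ i, ∀ x ∈ A.part i, θ x ∈ C.part i) ∧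
      ∃ c ∈ C.part 0, ∀ x y, ω x y = θ (A.bracket x y) + ω₀ x y • c

/-- `ω₀` does not vanish on some 2-cycle `∑ Xᵢ ⊗ Yᵢ` of `A`; so it is not a coboundary. -/
def NonzeroOnCycle (A : SuperAlgebra V) (ω₀ : V →ₗ[ℝ] V →ₗ[ℝ] ℝ) : Prop :=
  ∃ (n : ℕ) (X Y : Fin n → V), ∑ i, A.bracket (X i) (Y i) = 0 ∧ ∑ i, ω₀ (X i) (Y i) ≠ 0

theorem NonzeroOnCycle.eq_zero {A : SuperAlgebra V} {ω₀ : V →ₗ[ℝ] V →ₗ[ℝ] ℝ}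
    (h : NonzeroOnCycle A ω₀) {τ : V →ₗ[ℝ] Z} {c : Z}
    (hτ : ∀ x y, ω₀ x y • c = τ (A.bracket x y)) : c = 0 := by
  obtain ⟨n, X, Y, h0, h1⟩ := h
  have h2 : (∑ i, ω₀ (X i) (Y i)) • c = 0 := by
    rw [Finset.sum_smul, Finset.sum_congr rfl fun i _ => hτ (X i) (Y i), ← map_sum, h0, map_zero]
  exact (smul_eq_zero.mp h2).resolve_left h1

theorem zmod_two_cases (i : ZMod 2) : i = 0 ∨ i = 1 := by
  revert i; decide

@[simp] theorem koszul_zero_left (j : ZMod 2) : koszul 0 j = 1 := by simp [koszul]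

@[simp] theorem koszul_zero_right (j : ZMod 2) : koszul j 0 = 1 := by simp [koszul]

@[simp] theorem koszul_one_one : koszul 1 1 = -1 := by
  simp [koszul, show (1 : ZMod 2).val = 1 from rfl]

theorem koszul_comm (i j : ZMod 2) : koszul i j = koszul j i := by
  simp [koszul, mul_comm]

theorem koszul_mul_self (i j : ZMod 2) : koszul i j * koszul i j = 1 := by
  rcases zmod_two_cases i with rfl | rfl <;> rcases zmod_two_cases j with rfl | rfl <;> simp

theorem koszul_add_right (i j k : ZMod 2) : koszul i (j + k) = koszul i j * koszul i k := by
  rcases zmod_two_cases i with rfl | rfl <;> rcases zmod_two_cases j with rfl | rfl <;>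
    rcases zmod_two_cases k with rfl | rfl <;> simp [show (1 + 1 : ZMod 2) = 0 from rfl]

/-- Subtracting a coboundary from a cocycle. -/
theorem IsCocycle.sub_coboundary {A : SuperAlgebra V} {C : SuperAlgebra Z}
    {ω : V →ₗ[ℝ] V →ₗ[ℝ] Z} (hω : IsCocycle A C ω) (hA : IsLieSuperalgebra A)
    {θ : V →ₗ[ℝ] Z} (hθ : ∀ i, ∀ x ∈ A.part i, θ x ∈ C.part i) :
    IsCocycle A C (ω - A.bracket.compr₂ θ) where
  mem i j x hx y hy := sub_mem (hω.mem i j x hx y hy) (hθ _ _ (hA.bracket_mem i j x hx y hy))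
  skew i j x hx y hy := by
    simp only [LinearMap.sub_apply, LinearMap.compr₂_apply]
    rw [hω.skew i j x hx y hy, hA.skew i j x hx y hy]
    simp only [map_neg, map_smul]
    module
  cocycle i j x hx y hy z := by
    simp only [LinearMap.sub_apply, LinearMap.compr₂_apply]
    rw [hω.cocycle i j x hx y hy, hA.jacobi i j x hx y hy]
    simp only [map_add, map_smul]
    module

/-- Pulling a cocycle back along a homomorphism. -/
theorem IsCocycle.comp {A : SuperAlgebra V} {B : SuperAlgebra W} {C : SuperAlgebra Z}
    {ω : W →ₗ[ℝ] W →ₗ[ℝ] Z} (hω : IsCocycle B C ω) {f : V →ₗ[ℝ] W} (hf : IsHom A B f) :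
    IsCocycle A C (ω.compl₁₂ f f) where
  mem i j x hx y hy := hω.mem i j _ (hf.map_part i x hx) _ (hf.map_part j y hy)
  skew i j x hx y hy := hω.skew i j _ (hf.map_part i x hx) _ (hf.map_part j y hy)
  cocycle i j x hx y hy z := by
    simp only [LinearMap.compl₁₂_apply, hf.map_bracket]
    exact hω.cocycle i j _ (hf.map_part i x hx) _ (hf.map_part j y hy) _

/-- A retract of an algebra whose cocycles are spanned by `ω₀` has its cocycles spanned by the
restriction of `ω₀`. -/
theorem CocyclesSpannedBy.of_retract.{uZ} {A : SuperAlgebra V} {B : SuperAlgebra W}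
    {ω₀ : W →ₗ[ℝ] W →ₗ[ℝ] ℝ} (h : CocyclesSpannedBy.{uZ} B ω₀) {f : V →ₗ[ℝ] W} {g : W →ₗ[ℝ] V}
    (hf : IsHom A B f) (hg : IsHom B A g) (hgf : ∀ x, g (f x) = x) :
    CocyclesSpannedBy.{uZ} A (ω₀.compl₁₂ f f) := by
  intro Z _ _ C ω hω
  obtain ⟨θ, hθ, c, hc, h1⟩ := h Z C _ (hω.comp hg)
  refine ⟨θ ∘ₗ f, fun i x hx => hθ i _ (hf.map_part i x hx), c, hc, fun x y => ?_⟩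
  simpa [hgf, hf.map_bracket] using h1 (f x) (f y)

theorem isLieSuperalgebra_of_injective {A : SuperAlgebra V} {B : SuperAlgebra W}
    (hB : IsLieSuperalgebra B) {f : V →ₗ[ℝ] W} (hf : IsHom A B f) (hinj : Function.Injective f)
    (hpart : ∀ i x, f x ∈ B.part i → x ∈ A.part i) (hA : IsCompl (A.part 0) (A.part 1)) :
    IsLieSuperalgebra A where
  isCompl := hA
  bracket_mem i j x hx y hy := hpart _ _ <| by
    rw [hf.map_bracket]
    exact hB.bracket_mem i j _ (hf.map_part i x hx) _ (hf.map_part j y hy)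
  skew i j x hx y hy := hinj <| by
    simpa [hf.map_bracket] using hB.skew i j _ (hf.map_part i x hx) _ (hf.map_part j y hy)
  jacobi i j x hx y hy z := hinj <| by
    simpa [hf.map_bracket] using
      hB.jacobi i j _ (hf.map_part i x hx) _ (hf.map_part j y hy) (f z)

/-- A linear map which is surjective and preserves parity has a parity-preserving section. -/
theorem exists_even_section {E : SuperAlgebra W} {A : SuperAlgebra V}
    (hE : IsCompl (E.part 0) (E.part 1)) (hA : IsCompl (A.part 0) (A.part 1)) {π : W →ₗ[ℝ] V}
    (hπ : ∀ i, ∀ x ∈ E.part i, π x ∈ A.part i) (hsurj : Function.Surjective π) :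
    ∃ σ : V →ₗ[ℝ] W, (∀ x, π (σ x) = x) ∧ ∀ i, ∀ x ∈ A.part i, σ x ∈ E.part i := by
  obtain ⟨σ, hσ⟩ := π.exists_rightInverse_of_surjective (LinearMap.range_eq_top.mpr hsurj)
  have hσ' : ∀ x, π (σ x) = x := fun x => LinearMap.congr_fun hσ x
  let p0 : W →ₗ[ℝ] W := (E.part 0).projection (E.part 1) hE
  let p1 : W →ₗ[ℝ] W := (E.part 1).projection (E.part 0) hE.symm
  let q0 : V →ₗ[ℝ] V := (A.part 0).projection (A.part 1) hA
  let q1 : V →ₗ[ℝ] V := (A.part 1).projection (A.part 0) hA.symm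
  have hp0 : ∀ w, p0 w ∈ E.part 0 := fun w => Submodule.projection_apply_mem hE w
  have hp1 : ∀ w, p1 w ∈ E.part 1 := fun w => Submodule.projection_apply_mem hE.symm w
  have hp : ∀ w, p0 w + p1 w = w := fun w =>
    Submodule.projection_add_projection_eq_self hE w
  have hq : ∀ w, q0 w + q1 w = w := fun w =>
    Submodule.projection_add_projection_eq_self hA w
  have hq0 : ∀ w, q0 w ∈ A.part 0 := fun w => Submodule.projection_apply_mem hA w
  have hq1 : ∀ w, q1 w ∈ A.part 1 := fun w => Submodule.projection_apply_mem hA.symm w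
  have hd : ∀ x, x ∈ A.part 0 → x ∈ A.part 1 → x = 0 := fun x h0 h1 => by
    have := hA.disjoint.le_bot (Submodule.mem_inf.mpr ⟨h0, h1⟩)
    simpa using this
  have key0 : ∀ x ∈ A.part 0, π (p0 (σ x)) = x := fun x hx => by
    have h1 : π (p0 (σ x)) + π (p1 (σ x)) = x := by rw [← map_add, hp, hσ']
    have h2 : π (p1 (σ x)) = 0 := by
      refine hd _ ?_ (hπ 1 _ (hp1 _))
      rw [← eq_sub_iff_add_eq'] at h1
      rw [h1]
      exact sub_mem hx (hπ 0 _ (hp0 _))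
    rwa [h2, add_zero] at h1
  have key1 : ∀ x ∈ A.part 1, π (p1 (σ x)) = x := fun x hx => by
    have h1 : π (p0 (σ x)) + π (p1 (σ x)) = x := by rw [← map_add, hp, hσ']
    have h2 : π (p0 (σ x)) = 0 := by
      refine hd _ (hπ 0 _ (hp0 _)) ?_
      rw [← eq_sub_iff_add_eq] at h1
      rw [h1]
      exact sub_mem hx (hπ 1 _ (hp1 _))
    rwa [h2, zero_add] at h1
  refine ⟨p0 ∘ₗ σ ∘ₗ q0 + p1 ∘ₗ σ ∘ₗ q1, fun x => ?_, fun i x hx => ?_⟩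
  · simp only [LinearMap.add_apply, LinearMap.comp_apply, map_add]
    rw [key0 _ (hq0 x), key1 _ (hq1 x), hq]
  · rcases zmod_two_cases i with rfl | rfl
    · have : q1 x = 0 := hd _ (by
        have := hq x
        rw [← eq_sub_iff_add_eq'] at this
        rw [this]; exact sub_mem hx (hq0 x)) (hq1 x)
      simpa [this] using hp0 _
    · have : q0 x = 0 := hd _ (hq0 x) (by
        have := hq x
        rw [← eq_sub_iff_add_eq] at this
        rw [this]; exact sub_mem hx (hq1 x))
      simpa [this] using hp1 _

section Extension

variable {C : SuperAlgebra Z} {E : SuperAlgebra W} {A : SuperAlgebra V}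
  {ι : Z →ₗ[ℝ] W} {π : W →ₗ[ℝ] V}

/-- The inclusion of the kernel reflects parity. -/
theorem IsCentralExtension.mem_part (h : IsCentralExtension C E A ι π) {i : ZMod 2} {z : Z}
    (hz : ι z ∈ E.part i) : z ∈ C.part i := by
  obtain ⟨a, ha, b, hb, rfl⟩ : ∃ a ∈ C.part 0, ∃ b ∈ C.part 1, a + b = z := by
    have : z ∈ C.part 0 ⊔ C.part 1 := by rw [h.lie_left.isCompl.sup_eq_top]; trivial
    exact Submodule.mem_sup.mp this
  have hd : ∀ w, w ∈ E.part 0 → w ∈ E.part 1 → w = 0 := fun w h0 h1 => by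
    have := h.lie_mid.isCompl.disjoint.le_bot (Submodule.mem_inf.mpr ⟨h0, h1⟩)
    simpa using this
  have ha' := h.hom_left.map_part 0 a ha
  have hb' := h.hom_left.map_part 1 b hb
  rcases zmod_two_cases i with rfl | rfl
  · have : ι b = 0 := hd _ (by simpa using sub_mem hz ha') hb'
    have hb0 : b = 0 := h.injective (by simpa using this)
    simpa [hb0] using ha
  · have : ι a = 0 := hd _ ha' (by simpa using sub_mem hz hb')
    have ha0 : a = 0 := h.injective (by simpa using this)
    simpa [ha0] using hb

/-- Centrality on the other side, where the sign of the super-skew-symmetry is immaterial. -/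
theorem IsCentralExtension.central_right (h : IsCentralExtension C E A ι π) (w : W) (z : Z) :
    E.bracket w (ι z) = 0 := by
  have main : ∀ i j, ∀ x ∈ E.part i, ∀ y ∈ C.part j, E.bracket x (ι y) = 0 :=
    fun i j x hx y hy => by
      rw [h.lie_mid.skew i j x hx _ (h.hom_left.map_part j y hy), h.central]
      simp
  have hw : w ∈ E.part 0 ⊔ E.part 1 := by rw [h.lie_mid.isCompl.sup_eq_top]; trivial
  have hz : z ∈ C.part 0 ⊔ C.part 1 := by rw [h.lie_left.isCompl.sup_eq_top]; trivial
  obtain ⟨a, ha, b, hb, rfl⟩ := Submodule.mem_sup.mp hw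
  obtain ⟨c, hc, d, hd, rfl⟩ := Submodule.mem_sup.mp hz
  simp [main 0 0 a ha c hc, main 0 1 a ha d hd, main 1 0 b hb c hc, main 1 1 b hb d hd]

/-- If the cocycles of `A` are spanned by `ω₀`, then each central extension of `A` has an even
section whose failure to be a homomorphism is a multiple of `ω₀` by a central element. -/
theorem IsCentralExtension.exists_section.{uZ} {Z : Type uZ} [AddCommGroup Z] [Module ℝ Z]
    {C : SuperAlgebra Z} {ι : Z →ₗ[ℝ] W} {ω₀ : V →ₗ[ℝ] V →ₗ[ℝ] ℝ}
    (hA : CocyclesSpannedBy.{uZ} A ω₀) (h : IsCentralExtension C E A ι π) :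
    ∃ σ : V →ₗ[ℝ] W, (∀ x, π (σ x) = x) ∧ (∀ i, ∀ x ∈ A.part i, σ x ∈ E.part i) ∧
      ∃ c ∈ C.part 0, ∀ x y,
        E.bracket (σ x) (σ y) = σ (A.bracket x y) + ι (ω₀ x y • c) := by
  obtain ⟨σ, hσ, hpar⟩ := exists_even_section h.lie_mid.isCompl h.lie_right.isCompl
    h.hom_right.map_part h.surjective
  obtain ⟨κ, hκ⟩ := ι.exists_leftInverse_of_injective (LinearMap.ker_eq_bot.mpr h.injective)
  have hκι : ∀ z, κ (ι z) = z := fun z => LinearMap.congr_fun hκ z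
  have hικ : ∀ w, π w = 0 → ι (κ w) = w := fun w hw => by
    have : w ∈ LinearMap.range ι := by rw [h.exact]; exact hw
    obtain ⟨z, rfl⟩ := this
    rw [hκι]
  let ω : V →ₗ[ℝ] V →ₗ[ℝ] Z := (E.bracket.compl₁₂ σ σ - A.bracket.compr₂ σ).compr₂ κ
  have hω : ∀ x y, ι (ω x y) = E.bracket (σ x) (σ y) - σ (A.bracket x y) := fun x y => by
    have : ω x y = κ (E.bracket (σ x) (σ y) - σ (A.bracket x y)) := rfl
    rw [this, hικ]
    simp [h.hom_right.map_bracket, hσ]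
  -- the value on a bracket, modulo the central kernel
  have hb : ∀ x y, E.bracket (σ x) (σ y) = σ (A.bracket x y) + ι (ω x y) := fun x y => by
    rw [hω]; abel
  have hcoc : IsCocycle A C ω :=
    { mem := fun i j x hx y hy => h.mem_part <| by
        rw [hω]
        exact sub_mem (h.lie_mid.bracket_mem i j _ (hpar i x hx) _ (hpar j y hy))
          (hpar _ _ (h.lie_right.bracket_mem i j x hx y hy))
      skew := fun i j x hx y hy => h.injective <| by
        rw [map_neg, map_smul, hω, hω,
          h.lie_mid.skew i j _ (hpar i x hx) _ (hpar j y hy), h.lie_right.skew i j x hx y hy]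
        simp only [map_neg, map_smul]
        module
      cocycle := fun i j x hx y hy z => h.injective <| by
        have h1 := h.lie_mid.jacobi i j _ (hpar i x hx) _ (hpar j y hy) (σ z)
        simp only [hb, map_add, LinearMap.add_apply, h.central, h.central_right, add_zero,
          h.lie_right.jacobi i j x hx y hy z, map_smul, smul_add] at h1
        simp only [map_add, map_smul]
        exact add_left_cancel (h1.trans (by module)) }
  obtain ⟨θ, hθ, c, hc, hωc⟩ := hA Z C ω hcoc
  refine ⟨σ + ι ∘ₗ θ, fun x => ?_, fun i x hx => ?_, c, hc, fun x y => ?_⟩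
  · have : π (ι (θ x)) = 0 := by
      have : ι (θ x) ∈ LinearMap.ker π := by rw [← h.exact]; exact ⟨_, rfl⟩
      exact this
    simp [hσ, this]
  · exact add_mem (hpar i x hx) (h.hom_left.map_part i _ (hθ i x hx))
  · simp only [LinearMap.add_apply, LinearMap.comp_apply, map_add, h.central, h.central_right,
      hb, hωc]
    abel

end Extension

theorem onlyTrivialCentralExtensions_of_cocyclesSpannedBy_zero.{uZ, uW} {V : Type} [AddCommGroup V]
    [Module ℝ V] {A : SuperAlgebra V} (hA : CocyclesSpannedBy.{uZ} A 0) :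
    OnlyTrivialCentralExtensions.{uZ, uW} A := by
  intro Z _ _ W _ _ C E ι π h
  obtain ⟨σ, hσ, hpar, c, -, hb⟩ := h.exists_section hA
  exact ⟨σ, ⟨hpar, fun x y => by simp [hb]⟩, LinearMap.ext hσ⟩

@[simp] theorem extendBy_bracket (A : SuperAlgebra V) (ω : V →ₗ[ℝ] V →ₗ[ℝ] ℝ)
    (C : SuperAlgebra Z) (c : Z) (X Y : V × Z) :
    (extendBy A ω C c).bracket X Y = (A.bracket X.1 Y.1, ω X.1 Y.1 • c) := rfl

theorem centralExtensionsGivenBy_of_cocyclesSpannedBy.{uZ, uW} {V : Type} [AddCommGroup V]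
    [Module ℝ V] {A : SuperAlgebra V} {ω₀ : V →ₗ[ℝ] V →ₗ[ℝ] ℝ}
    (hA : CocyclesSpannedBy.{uZ} A ω₀) (hω : NonzeroOnCycle A ω₀) :
    CentralExtensionsGivenBy.{uZ, uW} A ω₀ := by
  intro Z _ _ W _ _ C E ι π h
  obtain ⟨σ, hσ, hpar, c, hc, hb⟩ := h.exists_section hA
  have hπι : ∀ z, π (ι z) = 0 := fun z => by
    have : ι z ∈ LinearMap.ker π := by rw [← h.exact]; exact ⟨_, rfl⟩
    exact this
  let ψ : V × Z →ₗ[ℝ] W := σ.coprod ι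
  have hψ : ∀ X, ψ X = σ X.1 + ι X.2 := fun X => rfl
  have hπψ : ∀ X, π (ψ X) = X.1 := fun X => by rw [hψ, map_add, hσ, hπι, add_zero]
  have hbij : Function.Bijective ψ := by
    refine ⟨(injective_iff_map_eq_zero ψ).mpr fun X hX => ?_, fun w => ?_⟩
    · have h1 : X.1 = 0 := by rw [← hπψ X, hX, map_zero]
      have h2 : ι X.2 = 0 := by rw [hψ, h1, map_zero, zero_add] at hX; exact hX
      exact Prod.ext h1 (h.injective (by simpa using h2))
    · have : w - σ (π w) ∈ LinearMap.range ι := by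
        rw [h.exact, LinearMap.mem_ker, map_sub, hσ, sub_self]
      obtain ⟨z, hz⟩ := this
      exact ⟨(π w, z), by rw [hψ, hz]; simp⟩
  have hψb : ∀ X Y, ψ ((extendBy A ω₀ C c).bracket X Y) = E.bracket (ψ X) (ψ Y) := fun X Y => by
    simp only [hψ, extendBy_bracket, map_add, LinearMap.add_apply, h.central, h.central_right,
      hb]
    simp
  let φ := LinearEquiv.ofBijective ψ hbij
  have hφ : ∀ X, φ X = ψ X := fun X => rfl
  refine ⟨c, ⟨hc, φ.symm, ⟨fun i w hw => ?_, fun x y => ?_⟩, ⟨fun i X hX => ?_, hψb⟩, ?_, ?_⟩, ?_⟩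
  · obtain ⟨X, rfl⟩ := φ.surjective w
    have h1 : X.1 ∈ A.part i := by
      rw [← hπψ X]
      exact h.hom_right.map_part i _ hw
    have h2 : ι X.2 ∈ E.part i := by
      have : ι X.2 = φ X - σ X.1 := by rw [hφ, hψ]; abel
      rw [this]
      exact sub_mem hw (hpar i _ h1)
    simp only [LinearEquiv.coe_coe, LinearEquiv.symm_apply_apply]
    exact ⟨h1, h.mem_part h2⟩
  · apply φ.injective
    simp only [LinearEquiv.coe_coe, LinearEquiv.apply_symm_apply]
    rw [hφ, hψb, ← hφ, ← hφ, LinearEquiv.apply_symm_apply, LinearEquiv.apply_symm_apply]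
  · exact add_mem (hpar i _ hX.1) (h.hom_left.map_part i _ hX.2)
  · refine LinearMap.ext fun z => φ.injective ?_
    simp only [LinearMap.comp_apply, LinearEquiv.coe_coe, LinearEquiv.apply_symm_apply]
    simp [hφ, hψ]
  · refine LinearMap.ext fun w => ?_
    obtain ⟨X, rfl⟩ := φ.surjective w
    simp only [LinearMap.comp_apply, LinearEquiv.coe_coe, LinearEquiv.symm_apply_apply]
    exact (hπψ X).symm
  · rintro c' ⟨-, χ, hχ, -, hχι, hχπ⟩
    -- `χ ∘ ψ` has the form `(X, z) ↦ (X, τ X + z)`, so `ω₀ • (c' - c)` is the coboundary of `τ`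
    let τ : V →ₗ[ℝ] Z := LinearMap.snd ℝ V Z ∘ₗ χ.toLinearMap ∘ₗ σ
    have h1 : ∀ w, (χ w).1 = π w := fun w => LinearMap.congr_fun hχπ w
    have h2 : ∀ z, χ (ι z) = (0, z) := fun z => LinearMap.congr_fun hχι z
    have h3 : c' - c = 0 := hω.eq_zero (τ := τ) fun x y => by
      have h4 := congrArg Prod.snd (hχ.map_bracket (σ x) (σ y))
      simp only [LinearEquiv.coe_coe, extendBy_bracket, h1, hσ, hb, map_add, h2,
        Prod.snd_add] at h4
      rw [smul_sub, ← h4]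
      simp [τ]
    exact sub_eq_zero.mp h3

theorem not_splits_extendBy {A : SuperAlgebra V} {ω₀ : V →ₗ[ℝ] V →ₗ[ℝ] ℝ}
    (hω : NonzeroOnCycle A ω₀) :
    ¬ Splits (extendBy A ω₀ line 1) A (LinearMap.fst ℝ V ℝ) := by
  rintro ⟨σ, hσ, hid⟩
  have h1 : ∀ x, (σ x).1 = x := fun x => LinearMap.congr_fun hid x
  refine one_ne_zero (α := ℝ) (hω.eq_zero (τ := LinearMap.snd ℝ V ℝ ∘ₗ σ) fun x y => ?_)
  have := congrArg Prod.snd (hσ.map_bracket x y)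
  simp only [extendBy_bracket, h1] at this
  exact this.symm

theorem isLieSuperalgebra_line : IsLieSuperalgebra line where
  isCompl := by simpa [line] using isCompl_top_bot
  bracket_mem := by simp [line]
  skew := by simp [line]
  jacobi := by simp [line]

theorem isLieSuperalgebra_extendBy {A : SuperAlgebra V} {C : SuperAlgebra Z}
    {ω : V →ₗ[ℝ] V →ₗ[ℝ] ℝ} {c : Z} (hA : IsLieSuperalgebra A)
    (hC : IsCompl (C.part 0) (C.part 1)) (hc : c ∈ C.part 0) (hω : IsCocycle A line ω) :
    IsLieSuperalgebra (extendBy A ω C c) where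
  isCompl := by
    constructor
    · rw [disjoint_iff, ← le_bot_iff]
      rintro ⟨x, z⟩ ⟨⟨h1, h2⟩, h3, h4⟩
      have e1 := hA.isCompl.disjoint.le_bot (Submodule.mem_inf.mpr ⟨h1, h3⟩)
      have e2 := hC.disjoint.le_bot (Submodule.mem_inf.mpr ⟨h2, h4⟩)
      simp only [Submodule.mem_bot] at e1 e2 ⊢
      simp [e1, e2]
    · rw [codisjoint_iff, ← top_le_iff]
      rintro ⟨x, z⟩ -
      have hx : x ∈ A.part 0 ⊔ A.part 1 := by rw [hA.isCompl.sup_eq_top]; trivial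
      have hz : z ∈ C.part 0 ⊔ C.part 1 := by rw [hC.sup_eq_top]; trivial
      obtain ⟨a, ha, b, hb, rfl⟩ := Submodule.mem_sup.mp hx
      obtain ⟨d, hd, e, he, rfl⟩ := Submodule.mem_sup.mp hz
      exact Submodule.mem_sup.mpr ⟨(a, d), ⟨ha, hd⟩, (b, e), ⟨hb, he⟩, rfl⟩
  bracket_mem i j x hx y hy := by
    refine ⟨hA.bracket_mem i j _ hx.1 _ hy.1, ?_⟩
    have h1 := hω.mem i j _ hx.1 _ hy.1
    by_cases hij : i + j = 0
    · rw [hij]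
      exact Submodule.smul_mem _ _ hc
    · have : ω x.1 y.1 = 0 := by simpa [line, hij] using h1
      simp [this]
  skew i j x hx y hy := by
    refine Prod.ext (hA.skew i j _ hx.1 _ hy.1) ?_
    simp only [extendBy_bracket, hω.skew i j _ hx.1 _ hy.1, Prod.snd_neg, Prod.smul_snd]
    module
  jacobi i j x hx y hy z := by
    refine Prod.ext (hA.jacobi i j _ hx.1 _ hy.1 _) ?_
    simp only [extendBy_bracket, hω.cocycle i j _ hx.1 _ hy.1, Prod.snd_add, Prod.smul_snd]
    module

theorem isCentralExtension_extendBy {A : SuperAlgebra V} {ω : V →ₗ[ℝ] V →ₗ[ℝ] ℝ}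
    (hA : IsLieSuperalgebra A) (hω : IsCocycle A line ω) :
    IsCentralExtension line (extendBy A ω line 1) A (LinearMap.inr ℝ V ℝ)
      (LinearMap.fst ℝ V ℝ) where
  lie_left := isLieSuperalgebra_line
  lie_mid := isLieSuperalgebra_extendBy hA isLieSuperalgebra_line.isCompl (by simp [line]) hω
  lie_right := hA
  hom_left := ⟨fun i z hz => ⟨zero_mem _, hz⟩, fun x y => by simp [line]⟩
  hom_right := ⟨fun i x hx => hx.1, fun x y => rfl⟩
  injective := LinearMap.inr_injective
  surjective := LinearMap.fst_surjective
  exact := (LinearMap.ker_fst ℝ V ℝ).symm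
  central z w := by simp

theorem hasCentralTerm_of_cocyclesSpannedBy.{uZ, uW} {V : Type} [AddCommGroup V]
    [Module ℝ V] {A : SuperAlgebra V} {ω₀ : V →ₗ[ℝ] V →ₗ[ℝ] ℝ} (hL : IsLieSuperalgebra A)
    (hcoc : IsCocycle A line ω₀) (hA : CocyclesSpannedBy.{uZ} A ω₀) (hω : NonzeroOnCycle A ω₀) :
    HasCentralTerm.{uZ, uW} A ω₀ :=
  ⟨isCentralExtension_extendBy hL hcoc, not_splits_extendBy hω,
    centralExtensionsGivenBy_of_cocyclesSpannedBy hA hω⟩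

end General

/-! ### Vector and quaternion identities -/

theorem cr_apply_zero (u v : V3) : cr u v 0 = u 1 * v 2 - u 2 * v 1 := by
  simp [cr]; ring

theorem cr_apply_one (u v : V3) : cr u v 1 = u 2 * v 0 - u 0 * v 2 := by
  simp [cr]; ring

theorem cr_apply_two (u v : V3) : cr u v 2 = u 0 * v 1 - u 1 * v 0 := by
  simp [cr]; ring

theorem dt_eq (u v : V3) : dt u v = u 0 * v 0 + u 1 * v 1 + u 2 * v 2 := by
  simp [dt]; ring

theorem nrm_eq (s t : ℍ[ℝ]) :
    nrm s t = s.re * t.re + s.imI * t.imI + s.imJ * t.imJ + s.imK * t.imK := by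
  simp [nrm]

theorem pol_apply_zero (c s t : ℍ[ℝ]) :
    pol c s t 0 = (1 / 2 : ℝ) * ((t * c * star s).imI + (s * c * star t).imI) := by
  simp [pol, mul_add]

theorem pol_apply_one (c s t : ℍ[ℝ]) :
    pol c s t 1 = (1 / 2 : ℝ) * ((t * c * star s).imJ + (s * c * star t).imJ) := by
  simp [pol, mul_add]

theorem pol_apply_two (c s t : ℍ[ℝ]) :
    pol c s t 2 = (1 / 2 : ℝ) * ((t * c * star s).imK + (s * c * star t).imK) := by
  simp [pol, mul_add]

theorem vec_ext {u v : V3} (h0 : u 0 = v 0) (h1 : u 1 = v 1) (h2 : u 2 = v 2) : u = v := by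
  ext i; fin_cases i <;> assumption

theorem cr_cr (u v w : V3) : cr u (cr v w) = dt u w • v - dt u v • w := by
  apply vec_ext <;> simp only [cr_apply_zero, cr_apply_one, cr_apply_two, dt_eq, Pi.sub_apply,
    Pi.smul_apply, smul_eq_mul] <;> ring

theorem cr_comm (u v : V3) : cr u v = -cr v u := by
  apply vec_ext <;> simp only [cr_apply_zero, cr_apply_one, cr_apply_two, Pi.neg_apply] <;> ring

theorem dt_comm (u v : V3) : dt u v = dt v u := by simp only [dt_eq]; ring
theorem dt_cr (u v w : V3) : dt (cr u v) w = dt u (cr v w) := by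
  simp only [dt_eq, cr_apply_zero, cr_apply_one, cr_apply_two]; ring

theorem nrm_comm (s t : ℍ[ℝ]) : nrm s t = nrm t s := by simp only [nrm_eq]; ring
theorem pol_comm (c s t : ℍ[ℝ]) : pol c s t = pol c t s := by simp only [pol, add_comm]

@[simp] theorem cr_zero_left (u : V3) : cr 0 u = 0 := by simp [cr]
@[simp] theorem cr_zero_right (u : V3) : cr u 0 = 0 := by simp [cr]
@[simp] theorem cr_self (u : V3) : cr u u = 0 := by simp [cr]
@[simp] theorem dt_zero_left (u : V3) : dt 0 u = 0 := by simp [dt]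
@[simp] theorem dt_zero_right (u : V3) : dt u 0 = 0 := by simp [dt]
@[simp] theorem nrm_zero_left (s : ℍ[ℝ]) : nrm 0 s = 0 := by simp [nrm]
@[simp] theorem nrm_zero_right (s : ℍ[ℝ]) : nrm s 0 = 0 := by simp [nrm]
@[simp] theorem pol_zero_left (c s : ℍ[ℝ]) : pol c 0 s = 0 := by simp [pol]
@[simp] theorem pol_zero_right (c s : ℍ[ℝ]) : pol c s 0 = 0 := by simp [pol]
@[simp] theorem pol_zero_coeff (s t : ℍ[ℝ]) : pol 0 s t = 0 := by simp [pol]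

theorem cr_add_right (u v w : V3) : cr u (v + w) = cr u v + cr u w := by
  apply vec_ext <;> simp only [cr_apply_zero, cr_apply_one, cr_apply_two, Pi.add_apply] <;> ring

theorem cr_sub_right (u v w : V3) : cr u (v - w) = cr u v - cr u w := by
  apply vec_ext <;> simp only [cr_apply_zero, cr_apply_one, cr_apply_two, Pi.sub_apply] <;> ring

theorem cr_neg_right (u v : V3) : cr u (-v) = -cr u v := by
  apply vec_ext <;> simp only [cr_apply_zero, cr_apply_one, cr_apply_two, Pi.neg_apply] <;> ring

theorem cr_neg_left (u v : V3) : cr (-u) v = -cr u v := by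
  apply vec_ext <;> simp only [cr_apply_zero, cr_apply_one, cr_apply_two, Pi.neg_apply] <;> ring

theorem cr_smul_left (r : ℝ) (u v : V3) : cr (r • u) v = r • cr u v := by
  apply vec_ext <;> simp only [cr_apply_zero, cr_apply_one, cr_apply_two, Pi.smul_apply,
    smul_eq_mul] <;> ring

theorem cr_smul_right (r : ℝ) (u v : V3) : cr u (r • v) = r • cr u v := by
  apply vec_ext <;> simp only [cr_apply_zero, cr_apply_one, cr_apply_two, Pi.smul_apply,
    smul_eq_mul] <;> ring

theorem dt_neg_right (u v : V3) : dt u (-v) = -dt u v := by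
  simp only [dt_eq, Pi.neg_apply]; ring

theorem dt_neg_left (u v : V3) : dt (-u) v = -dt u v := by
  simp only [dt_eq, Pi.neg_apply]; ring

theorem dt_smul_left (r : ℝ) (u v : V3) : dt (r • u) v = r * dt u v := by
  simp only [dt_eq, Pi.smul_apply, smul_eq_mul]; ring

theorem dt_smul_right (r : ℝ) (u v : V3) : dt u (r • v) = r * dt u v := by
  simp only [dt_eq, Pi.smul_apply, smul_eq_mul]; ring

theorem pol_add_coeff (c d s t : ℍ[ℝ]) : pol (c + d) s t = pol c s t + pol d s t := by
  simp only [pol, mul_add, add_mul, smul_add, map_add]; abel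

theorem pol_smul_coeff (r : ℝ) (c s t : ℍ[ℝ]) : pol (r • c) s t = r • pol c s t := by
  simp only [pol, mul_smul_comm, smul_mul_assoc, ← smul_add, map_smul, smul_comm r]

@[simp] theorem pol_one_coeff (s t : ℍ[ℝ]) : pol 1 s t = 0 := by
  apply vec_ext <;> simp [pol] <;> ring

theorem toH_cr (u v : V3) : toH (cr u v) = (1 / 2 : ℝ) • (toH u * toH v - toH v * toH u) := by
  ext <;> simp [cr_apply_zero, cr_apply_one, cr_apply_two] <;> ring

theorem toH_mul_toH (u v : V3) : toH u * toH v = toH (cr u v) - ((dt u v : ℝ) : ℍ[ℝ]) := by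
  ext <;> simp [cr_apply_zero, cr_apply_one, cr_apply_two, dt_eq] <;> ring

theorem toH_pol {c : ℍ[ℝ]} (hc : c.re = 0) (s t : ℍ[ℝ]) :
    toH (pol c s t) = (1 / 2 : ℝ) • (t * c * star s + s * c * star t) := by
  ext <;> simp [pol, hc] <;> ring

/-- The polarisation of `s c s̄ s = |s|² s c`. -/
theorem pol_cyclic {c : ℍ[ℝ]} (hc : c.re = 0) (s t r : ℍ[ℝ]) :
    toH (pol c t r) * s + toH (pol c s t) * r + toH (pol c r s) * t =
      nrm t r • (s * c) + nrm s t • (r * c) + nrm r s • (t * c) := by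
  ext <;> simp [toH_pol hc, nrm_eq, hc] <;> ring

theorem nrm_rot (u : V3) (s t : ℍ[ℝ]) : nrm (toH u * s) t + nrm s (toH u * t) = 0 := by
  simp [nrm_eq]; ring

theorem nrm_mul_right (h s t : ℍ[ℝ]) : nrm (s * h) t + nrm s (t * h) = 2 * h.re * nrm s t := by
  simp [nrm_eq]; ring

theorem nrm_twist (u : V3) (b s t : ℍ[ℝ]) :
    nrm (toH u * s * b) t + nrm s (toH u * t * b) = -2 * dt u (pol b s t) := by
  simp [nrm_eq, dt_eq, pol_apply_zero, pol_apply_one, pol_apply_two]; ring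

theorem pol_rot (c : ℍ[ℝ]) (u : V3) (s t : ℍ[ℝ]) :
    pol c (toH u * s) t + pol c s (toH u * t) = (2 : ℝ) • cr u (pol c s t) := by
  apply vec_ext <;> simp [cr_apply_zero, cr_apply_one, cr_apply_two, pol_apply_zero, pol_apply_one,
    pol_apply_two] <;> ring

/-- The derivation `s ↦ s h` of the quadratic map `s ↦ s c s̄`. -/
theorem pol_mul_right (c h s t : ℍ[ℝ]) :
    pol c (s * h) t + pol c s (t * h) = pol (h * c + c * star h) s t := by
  simp only [pol, star_mul, mul_add, add_mul, mul_assoc, ← map_add, ← smul_add]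
  congr 2
  abel

/-- The derivation `s ↦ u s b` of the quadratic map `s ↦ s c s̄`: the real part of `b c` contributes
the vector `|s|² u`, the imaginary part a cross product with `u`. -/
theorem pol_twist {c : ℍ[ℝ]} (hc : c.re = 0) (u : V3) (b s t : ℍ[ℝ]) :
    pol c (toH u * s * b) t + pol c s (toH u * t * b) =
      (2 * (b * c).re * nrm s t) • u + (2 : ℝ) • cr u (pol (b * c) s t) := by
  apply vec_ext <;> simp [cr_apply_zero, cr_apply_one, cr_apply_two, pol_apply_zero, pol_apply_one, 
    pol_apply_two, nrm_eq, hc] <;> ring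

/-! ### The Jacobi identity for kinematical superalgebras -/

/-- The conditions on the structure constants which give the Jacobi identities not involving `J`.
A field whose name begins with three letters comes from three generators of these types, and the
letter or word after it says which component of the identity it is. -/
structure KinData.JacobiConditions (D : KinData) : Prop where
  c1_re : D.c1.re = 0
  c2_re : D.c2.re = 0
  c3_re : D.c3.re = 0
  HBB_J : D.even.HB_B * D.even.BB_J = 0
  HBB_B : D.even.BB_B * D.even.HB_B + D.even.BB_P * D.even.HP_B
    = 2 * D.even.HB_B * D.even.BB_B
  HBB_P : D.even.BB_B * D.even.HB_P + D.even.BB_P * D.even.HP_P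
    = 2 * D.even.HB_B * D.even.BB_P
  HBP_H : (D.even.HB_B + D.even.HP_P) * D.even.BP_H = 0
  HBP_J : D.even.HB_P * D.even.PP_J + D.even.HP_B * D.even.BB_J = 0
  HBP_B : D.even.HB_P * D.even.PP_B + D.even.HP_B * D.even.BB_B = 0
  HBP_P : D.even.HP_B * D.even.BB_P = 0
  HPP_J : D.even.HP_P * D.even.PP_J = 0
  HPP_B : D.even.PP_B * D.even.HB_B = 2 * D.even.HP_P * D.even.PP_B
  HPP_P : D.even.PP_B * D.even.HB_P = 0
  BBB_H : D.even.BB_P * D.even.BP_H = 0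
  BBP_B : D.even.BP_H * D.even.HB_B = D.even.BB_P * D.even.PP_B
  BBP_P : D.even.BP_H * D.even.HB_P = D.even.BB_J
  BBP_H : D.even.BB_B * D.even.BP_H = 0
  BBP_J : D.even.BB_P * D.even.PP_J = 0
  BPP_B : D.even.PP_J + D.even.PP_B * D.even.BB_B = -(D.even.BP_H * D.even.HP_B)
  BPP_P : D.even.PP_B * D.even.BB_P = -(D.even.BP_H * D.even.HP_P)
  BPP_J : D.even.PP_B * D.even.BB_J = 0
  PPP_H : D.even.PP_B * D.even.BP_H = 0
  HBQ : D.b * D.h - D.h * D.b = D.even.HB_B • D.b + D.even.HB_P • D.p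
  HPQ : D.p * D.h - D.h * D.p = D.even.HP_B • D.b + D.even.HP_P • D.p
  BBQ : (2 : ℝ) • (D.b * D.b)
    = (D.even.BB_J / 2) • 1 + D.even.BB_B • D.b + D.even.BB_P • D.p
  BPQ_cr : D.p * D.b + D.b * D.p = 0
  BPQ_dt : D.b * D.p - D.p * D.b = D.even.BP_H • D.h
  PPQ : (2 : ℝ) • (D.p * D.p) = (D.even.PP_J / 2) • 1 + D.even.PP_B • D.b
  HQQ_H : D.c0 * D.h.re = 0
  HQQ_J : D.h * D.c1 + D.c1 * star D.h = 0
  HQQ_B : D.h * D.c2 + D.c2 * star D.h = D.even.HB_B • D.c2 + D.even.HP_B • D.c3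
  HQQ_P : D.h * D.c3 + D.c3 * star D.h = D.even.HB_P • D.c2 + D.even.HP_P • D.c3
  BQQ_J : (2 : ℝ) • (D.b * D.c1) = D.even.BB_J • D.c2
  BQQ_B : (2 : ℝ) • (D.b * D.c2)
    = (D.c0 * D.even.HB_B) • 1 + D.c1 + D.even.BB_B • D.c2
  BQQ_P : (2 : ℝ) • (D.b * D.c3) = (D.c0 * D.even.HB_P) • 1 + D.even.BB_P • D.c2
  BQQ_H : D.even.BP_H • D.c3 = (2 * D.c0) • (D.b - D.b.re • 1)
  PQQ_J : (2 : ℝ) • (D.p * D.c1) = D.even.PP_J • D.c3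
  PQQ_B : (2 : ℝ) • (D.p * D.c2) = (D.c0 * D.even.HP_B) • 1 + D.even.PP_B • D.c3
  PQQ_P : (2 : ℝ) • (D.p * D.c3) = (D.c0 * D.even.HP_P) • 1 + D.c1
  PQQ_H : -(D.even.BP_H • D.c2) = (2 * D.c0) • (D.p - D.p.re • 1)
  QQQ : D.c0 • D.h = (1 / 2 : ℝ) • D.c1 + D.c2 * D.b + D.c3 * D.p

theorem cr_leibniz (u v w : V3) : cr u (cr v w) = cr (cr u v) w + cr v (cr u w) := by
  apply vec_ext <;> simp only [cr_apply_zero, cr_apply_one, cr_apply_two, Pi.add_apply] <;> ring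

theorem pol_smul_mid (r : ℝ) (c s t : ℍ[ℝ]) : pol c (r • s) t = r • pol c s t := by
  simp only [pol, Quaternion.star_smul, mul_smul_comm, smul_mul_assoc, ← smul_add, map_smul,
    smul_comm r]

theorem pol_smul_right (r : ℝ) (c s t : ℍ[ℝ]) : pol c s (r • t) = r • pol c s t := by
  rw [pol_comm, pol_smul_mid, pol_comm]

theorem nrm_smul_left (r : ℝ) (s t : ℍ[ℝ]) : nrm (r • s) t = r * nrm s t := by
  simp [nrm_eq]; ring

theorem nrm_smul_right (r : ℝ) (s t : ℍ[ℝ]) : nrm s (r • t) = r * nrm s t := by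
  simp [nrm_eq]; ring

theorem kinAlgebra_bracket (D : KinData) (X Y : KinSpace) :
    (kinAlgebra D).bracket X Y = kinBracketFun D X Y := rfl

theorem mem_kinAlgebra_part_zero {D : KinData} {X : KinSpace} :
    X ∈ (kinAlgebra D).part 0 ↔ X.2 = 0 := by
  simp [kinAlgebra]

theorem mem_kinAlgebra_part_one {D : KinData} {X : KinSpace} :
    X ∈ (kinAlgebra D).part 1 ↔ X.1 = 0 := by
  simp [kinAlgebra]

/-- The generators of a kinematical superalgebra. -/
inductive Gen
  | J (u : V3) | B (u : V3) | P (u : V3) | H | Q (s : ℍ[ℝ])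

namespace Gen

/-- The generator as an element of the superalgebra. -/
noncomputable def el : Gen → KinSpace
  | J u => ((u, 0, 0, 0), 0)
  | B u => ((0, u, 0, 0), 0)
  | P u => ((0, 0, u, 0), 0)
  | H => ((0, 0, 0, 1), 0)
  | Q s => ((0, 0, 0, 0), s)

/-- The parity of a generator. -/
def par : Gen → ZMod 2
  | Q _ => 1
  | _ => 0

/-- A total order on the types of generators. -/
def rank : Gen → ℕ
  | J _ => 0
  | B _ => 1
  | P _ => 2
  | H => 3
  | Q _ => 4

theorem el_mem (D : KinData) (g : Gen) : g.el ∈ (kinAlgebra D).part g.par := by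
  cases g <;> simp [el, par, mem_kinAlgebra_part_zero, mem_kinAlgebra_part_one]

theorem eq_sum (X : KinSpace) :
    X = (J X.1.1).el + (B X.1.2.1).el + (P X.1.2.2.1).el + X.1.2.2.2 • H.el + (Q X.2).el := by
  obtain ⟨⟨ω, β, π, t⟩, s⟩ := X
  simp [el]

end Gen

theorem kinAlgebra_isCompl (D : KinData) :
    IsCompl ((kinAlgebra D).part 0) ((kinAlgebra D).part 1) := by
  constructor
  · rw [disjoint_iff, ← le_bot_iff]
    rintro X ⟨h0, h1⟩
    exact Prod.ext (mem_kinAlgebra_part_one.mp h1) (mem_kinAlgebra_part_zero.mp h0)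
  · rw [codisjoint_iff, ← top_le_iff]
    rintro ⟨x, s⟩ -
    exact Submodule.mem_sup.mpr ⟨(x, 0), mem_kinAlgebra_part_zero.mpr rfl, (0, s),
      mem_kinAlgebra_part_one.mpr rfl, by simp⟩

theorem kinAlgebra_bracket_mem (D : KinData) (i j : ZMod 2) (x : KinSpace)
    (hx : x ∈ (kinAlgebra D).part i) (y : KinSpace) (hy : y ∈ (kinAlgebra D).part j) :
    (kinAlgebra D).bracket x y ∈ (kinAlgebra D).part (i + j) := by
  obtain ⟨⟨ω, β, π, t⟩, s⟩ := x
  obtain ⟨⟨ω', β', π', t'⟩, s'⟩ := y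
  rw [kinAlgebra_bracket]
  rcases zmod_two_cases i with rfl | rfl <;> rcases zmod_two_cases j with rfl | rfl <;>
    simp only [add_zero, zero_add, show (1 + 1 : ZMod 2) = 0 from rfl, mem_kinAlgebra_part_zero,
      mem_kinAlgebra_part_one, Prod.mk_eq_zero] at hx hy ⊢
  · simp [kinBracketFun, hx, hy]
  · simp [kinBracketFun, hx, hy]
  · simp [kinBracketFun, hx, hy]
  · simp [kinBracketFun, hx, hy]

theorem kinAlgebra_skew (D : KinData) (i j : ZMod 2) (x : KinSpace)
    (hx : x ∈ (kinAlgebra D).part i) (y : KinSpace) (hy : y ∈ (kinAlgebra D).part j) :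
    (kinAlgebra D).bracket x y = -(koszul i j • (kinAlgebra D).bracket y x) := by
  obtain ⟨⟨ω, β, π, t⟩, s⟩ := x
  obtain ⟨⟨ω', β', π', t'⟩, s'⟩ := y
  simp only [kinAlgebra_bracket]
  rcases zmod_two_cases i with rfl | rfl <;> rcases zmod_two_cases j with rfl | rfl <;>
    simp only [mem_kinAlgebra_part_zero, mem_kinAlgebra_part_one, Prod.mk_eq_zero] at hx hy ⊢
  · subst hx hy
    simp only [kinBracketFun, pol_zero_left, nrm_zero_left, koszul_zero_left, one_smul,
      Prod.neg_mk, cr_comm ω' _, cr_comm β' _, cr_comm π' _, Prod.mk.injEq]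
    refine ⟨⟨?_, ?_, ?_, ?_⟩, ?_⟩
    · module
    · module
    · module
    · ring
    · simp
  · obtain ⟨rfl, rfl, rfl, rfl⟩ := hy
    subst hx
    simp [kinBracketFun]
    abel
  · obtain ⟨rfl, rfl, rfl, rfl⟩ := hx
    subst hy
    simp [kinBracketFun]
    abel
  · obtain ⟨rfl, rfl, rfl, rfl⟩ := hx
    obtain ⟨rfl, rfl, rfl, rfl⟩ := hy
    simp [kinBracketFun, pol_comm _ s', nrm_comm s']

/-- The super Jacobi identity for three generators. -/
def GenJacobi (D : KinData) (x y z : Gen) : Prop :=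
  (kinAlgebra D).bracket x.el ((kinAlgebra D).bracket y.el z.el)
    = (kinAlgebra D).bracket ((kinAlgebra D).bracket x.el y.el) z.el
      + koszul x.par y.par • (kinAlgebra D).bracket y.el ((kinAlgebra D).bracket x.el z.el)

section Permute

variable {D : KinData} {x y z : Gen}

theorem gen_skew (D : KinData) (x y : Gen) : (kinAlgebra D).bracket x.el y.el
    = -(koszul x.par y.par • (kinAlgebra D).bracket y.el x.el) :=
  kinAlgebra_skew D _ _ _ (x.el_mem D) _ (y.el_mem D)

theorem GenJacobi.swap_left (h : GenJacobi D x y z) : GenJacobi D y x z := by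
  unfold GenJacobi at h ⊢
  rw [h, gen_skew D y x]
  simp only [map_neg, map_smul, LinearMap.neg_apply, LinearMap.smul_apply, smul_add, smul_smul,
    koszul_comm y.par x.par, koszul_mul_self, one_smul]
  abel

theorem GenJacobi.swap_right (h : GenJacobi D x y z) : GenJacobi D x z y := by
  unfold GenJacobi at h ⊢
  have e1 := kinAlgebra_skew D _ _ _ (kinAlgebra_bracket_mem D _ _ _ (x.el_mem D) _ (z.el_mem D))
    _ (y.el_mem D)
  have e2 := kinAlgebra_skew D _ _ _ (z.el_mem D) _
    (kinAlgebra_bracket_mem D _ _ _ (x.el_mem D) _ (y.el_mem D))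
  rw [gen_skew D z y, map_neg, map_smul, h, e1, e2, koszul_comm (x.par + z.par), koszul_add_right,
    koszul_add_right]
  generalize (kinAlgebra D).bracket (((kinAlgebra D).bracket x.el) z.el) y.el = a
  generalize (kinAlgebra D).bracket z.el (((kinAlgebra D).bracket x.el) y.el) = b
  rcases zmod_two_cases x.par with hx | hx <;> rcases zmod_two_cases y.par with hy | hy <;>
    rcases zmod_two_cases z.par with hz | hz <;>
    simp only [hx, hy, hz, koszul_zero_left, koszul_zero_right, koszul_one_one] <;> module

/-- The Jacobi identity for all generators follows from that for triples of sorted types. -/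
theorem genJacobi_of_sorted
    (h : ∀ x y z : Gen, x.rank ≤ y.rank → y.rank ≤ z.rank → GenJacobi D x y z) (x y z : Gen) :
    GenJacobi D x y z := by
  rcases le_total x.rank y.rank with hxy | hxy <;> rcases le_total y.rank z.rank with hyz | hyz <;>
    rcases le_total x.rank z.rank with hxz | hxz
  · exact h _ _ _ hxy hyz
  · exact h _ _ _ hxy hyz
  · exact (h _ _ _ hxz hyz).swap_right
  · exact (h _ _ _ hxz hxy).swap_left.swap_right
  · exact (h _ _ _ hxy hxz).swap_left
  · exact (h _ _ _ hyz hxz).swap_right.swap_left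
  · exact (h _ _ _ hyz hxy).swap_left.swap_right.swap_left
  · exact (h _ _ _ hyz hxy).swap_left.swap_right.swap_left

end Permute

theorem jacobi_of_generators {D : KinData} (h : ∀ x y z, GenJacobi D x y z) (i j : ZMod 2)
    (x : KinSpace) (hx : x ∈ (kinAlgebra D).part i) (y : KinSpace)
    (hy : y ∈ (kinAlgebra D).part j) (z : KinSpace) :
    (kinAlgebra D).bracket x ((kinAlgebra D).bracket y z)
      = (kinAlgebra D).bracket ((kinAlgebra D).bracket x y) z
        + koszul i j • (kinAlgebra D).bracket y ((kinAlgebra D).bracket x z) := by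
  have hz : ∀ x y : Gen, ∀ z, (kinAlgebra D).bracket x.el ((kinAlgebra D).bracket y.el z)
      = (kinAlgebra D).bracket ((kinAlgebra D).bracket x.el y.el) z
        + koszul x.par y.par • (kinAlgebra D).bracket y.el ((kinAlgebra D).bracket x.el z) := by
    intro x y z
    rw [Gen.eq_sum z]
    simp only [map_add, map_smul, smul_add]
    rw [h x y (.J _), h x y (.B _), h x y (.P _), h x y .H, h x y (.Q _)]
    module
  have hd : ∀ k, ∀ w ∈ (kinAlgebra D).part k,
      w ∈ Submodule.span ℝ {v | ∃ g : Gen, g.par = k ∧ g.el = v} := by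
    intro k w hw
    rcases zmod_two_cases k with rfl | rfl
    · rw [mem_kinAlgebra_part_zero] at hw
      rw [Gen.eq_sum w, hw]
      refine add_mem (add_mem (add_mem (add_mem ?_ ?_) ?_) (Submodule.smul_mem _ _ ?_)) ?_
      · exact Submodule.subset_span ⟨.J _, rfl, rfl⟩
      · exact Submodule.subset_span ⟨.B _, rfl, rfl⟩
      · exact Submodule.subset_span ⟨.P _, rfl, rfl⟩
      · exact Submodule.subset_span ⟨.H, rfl, rfl⟩
      · exact zero_mem _
    · rw [mem_kinAlgebra_part_one] at hw
      exact Submodule.subset_span ⟨.Q w.2, rfl, Prod.ext hw.symm rfl⟩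
  have hxy : ∀ x ∈ Submodule.span ℝ {v | ∃ g : Gen, g.par = i ∧ g.el = v},
      ∀ y ∈ Submodule.span ℝ {v | ∃ g : Gen, g.par = j ∧ g.el = v},
      (kinAlgebra D).bracket x ((kinAlgebra D).bracket y z)
        = (kinAlgebra D).bracket ((kinAlgebra D).bracket x y) z
          + koszul i j • (kinAlgebra D).bracket y ((kinAlgebra D).bracket x z) := by
    intro x hx y hy
    induction hx using Submodule.span_induction with
    | mem x hx =>
      obtain ⟨g, rfl, rfl⟩ := hx
      induction hy using Submodule.span_induction with
      | mem y hy =>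
        obtain ⟨g', rfl, rfl⟩ := hy
        exact hz g g' z
      | zero => simp
      | add y y' _ _ ih ih' =>
        simp only [map_add, LinearMap.add_apply, ih, ih']
        module
      | smul r y _ ih =>
        simp only [map_smul, LinearMap.smul_apply, ih]
        module
    | zero => simp
    | add x x' _ _ ih ih' =>
      simp only [map_add, LinearMap.add_apply, ih, ih']
      module
    | smul r x _ ih =>
      simp only [map_smul, LinearMap.smul_apply, ih]
      module
  exact hxy x (hd i x hx) y (hd j y hy)

section GeneratorJacobi

variable {D : KinData}

/-- The brackets are equivariant under rotations, whatever the structure constants. -/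
theorem genJacobi_J (u : V3) (y z : Gen) : GenJacobi D (.J u) y z := by
  have hp : ∀ c s t, cr u (pol c s t)
      = pol c ((1 / 2 : ℝ) • (toH u * s)) t + pol c s ((1 / 2 : ℝ) • (toH u * t)) := by
    intro c s t
    rw [pol_smul_mid, pol_smul_right, ← smul_add, pol_rot, smul_smul]
    norm_num
  have hn : ∀ s t, nrm ((1 / 2 : ℝ) • (toH u * s)) t + nrm s ((1 / 2 : ℝ) • (toH u * t)) = 0 := by
    intro s t
    rw [nrm_smul_left, nrm_smul_right, ← mul_add, nrm_rot, mul_zero]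
  have hq : ∀ v, ∀ s : ℍ[ℝ], toH u * (toH v * s) = toH (cr u v) * s + toH v * (toH u * s)
      + toH (cr u v) * s := by
    intro v s
    rw [toH_cr]
    simp only [smul_sub, sub_mul, smul_mul_assoc, mul_assoc]
    module
  unfold GenJacobi
  simp only [Gen.par, koszul_zero_left, one_smul]
  generalize y.el = Y
  generalize z.el = Z
  obtain ⟨⟨ω, β, π, t⟩, s⟩ := Y
  obtain ⟨⟨ω', β', π', t'⟩, s'⟩ := Z
  simp only [kinAlgebra_bracket, kinBracketFun, Gen.el, cr_zero_left, dt_zero_left,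
    dt_zero_right, pol_zero_left, nrm_zero_left, map_zero, zero_mul, mul_zero, smul_zero, zero_smul,
    sub_zero, add_zero, sub_self, Prod.mk_add_mk, Prod.mk.injEq]
  refine ⟨⟨?_, ?_, ?_, ?_⟩, ?_⟩
  · simp only [cr_add_right, cr_sub_right, cr_smul_right, hp, cr_leibniz u ω, cr_leibniz u β,
      cr_leibniz u π]
    module
  · simp only [cr_add_right, cr_sub_right, cr_smul_right, hp, cr_leibniz u ω, cr_leibniz u β,
      cr_leibniz u π]
    module
  · simp only [cr_add_right, cr_sub_right, cr_smul_right, hp, cr_leibniz u ω, cr_leibniz u β,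
      cr_leibniz u π]
    module
  · have e1 : dt (cr u β) π' + dt β (cr u π') = 0 := by
      rw [cr_comm u β, dt_neg_left, dt_cr, neg_add_cancel]
    have e2 : dt (cr u β') π + dt β' (cr u π) = 0 := by
      rw [cr_comm u β', dt_neg_left, dt_cr, neg_add_cancel]
    linear_combination (-D.even.BP_H) * e1 + D.even.BP_H * e2 - D.c0 * hn s s'
  · simp only [mul_add, mul_sub, mul_smul_comm, smul_mul_assoc, mul_assoc, hq, smul_add, smul_sub]
    module

end GeneratorJacobi

theorem cr_cr_left (u v w : V3) : cr (cr u v) w = dt u w • v - dt v w • u := by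
  rw [cr_comm, cr_cr, dt_comm w v, dt_comm w u]
  module

theorem pol_neg_coeff (c s t : ℍ[ℝ]) : pol (-c) s t = -pol c s t := by
  simpa using pol_smul_coeff (-1) c s t

theorem pol_sub_coeff (c d s t : ℍ[ℝ]) : pol (c - d) s t = pol c s t - pol d s t := by
  rw [sub_eq_add_neg, pol_add_coeff, pol_neg_coeff, sub_eq_add_neg]

theorem toH_mul_mul (u v : V3) (q : ℍ[ℝ]) :
    toH u * (toH v * q) = toH (cr u v) * q - dt u v • q := by
  rw [← mul_assoc, toH_mul_toH, sub_mul, Quaternion.coe_mul_eq_smul]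

set_option maxHeartbeats 1000000 in
theorem KinData.JacobiConditions.genJacobi {D : KinData} (h : D.JacobiConditions) (x y z : Gen) :
    GenJacobi D x y z := by
  refine genJacobi_of_sorted (fun x y z hxy hyz => ?_) x y z
  rcases x with u | u | u | _ | r
  · exact genJacobi_J u y z
  all_goals
    rcases y with v | v | v | _ | s <;> rcases z with w | w | w | _ | t <;>
      simp only [Gen.rank, Nat.reduceLeDiff] at hxy hyz <;>
      simp only [GenJacobi, Gen.par, koszul_zero_left, koszul_one_one, one_smul,
        kinAlgebra_bracket, kinBracketFun, Gen.el, cr_zero_left, cr_zero_right, dt_zero_left,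
        dt_zero_right, pol_zero_left, pol_zero_right, nrm_zero_left, nrm_zero_right, map_zero,
        zero_mul, mul_zero, smul_zero, zero_smul, sub_zero, add_zero, zero_add, zero_sub, neg_zero,
        sub_self, Prod.mk_add_mk, Prod.smul_mk, Prod.mk.injEq,
        true_and, and_true, smul_eq_mul,
        cr_smul_right, cr_smul_left, cr_neg_right, dt_smul_left, dt_smul_right,
        dt_neg_left, dt_neg_right, cr_self, smul_neg, mul_neg, neg_neg, map_smul,
        map_neg, smul_mul_assoc, neg_mul]
  -- `B B B`
  · refine ⟨?_, ?_, ?_, ?_⟩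
    · rw [cr_leibniz u v w]; module
    · rw [cr_leibniz u v w]; module
    · rw [cr_leibniz u v w]; module
    · rw [dt_comm w, dt_cr, dt_comm v, dt_cr, cr_comm w v, dt_neg_right]
      linear_combination 3 * dt u (cr v w) * h.BBB_H
  -- `B B P`
  · rw [cr_cr_left]
    refine ⟨?_, ?_, ?_, ?_⟩
    · linear_combination (norm := module) -(h.BBP_J • (dt u w • v - dt v w • u))
    · linear_combination (norm := module) h.BBP_B • (dt u w • v - dt v w • u)
    · linear_combination (norm := module) h.BBP_P • (dt u w • v - dt v w • u)
    · linear_combination -dt (cr u v) w * h.BBP_H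
  -- `B B H`
  · rw [cr_comm v u]
    refine ⟨?_, ?_, ?_, ?_⟩
    · linear_combination (norm := module) -(2 : ℝ) • (h.HBB_J • cr u v)
    · linear_combination (norm := module) h.HBB_B • cr u v
    · linear_combination (norm := module) h.HBB_P • cr u v
    · rw [dt_comm]
  -- `B B Q`
  · have e := congrArg (fun q => toH (cr u v) * t * q) h.BBQ
    simp only [mul_add, mul_smul_comm, mul_one, ← mul_assoc] at e
    simp only [mul_assoc, toH_mul_mul, cr_comm v u, dt_comm v u, map_neg, neg_mul, sub_mul,
      smul_mul_assoc] at e ⊢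
    linear_combination (norm := module) e
  -- `B P P`
  · rw [cr_cr]
    refine ⟨?_, ?_, ?_⟩
    · linear_combination (norm := module) h.BPP_J • (dt u w • v - dt u v • w)
    · linear_combination (norm := module) h.BPP_B • (dt u w • v - dt u v • w)
    · linear_combination (norm := module) h.BPP_P • (dt u w • v - dt u v • w)
  -- `B P H`
  · rw [cr_comm v u]
    refine ⟨?_, ?_, ?_, ?_⟩
    · linear_combination (norm := module) -(h.HBP_J • cr u v)
    · linear_combination (norm := module) -(h.HBP_B • cr u v)
    · linear_combination (norm := module) -(h.HBP_P • cr u v)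
    · linear_combination -dt u v * h.HBP_H
  -- `B P Q`
  · have e := congrArg (fun q => toH (cr u v) * t * q) h.BPQ_cr
    have e' := congrArg (fun q => dt u v • (t * q)) h.BPQ_dt
    simp only [mul_add, mul_sub, mul_smul_comm, mul_zero, smul_sub, ← mul_assoc] at e e'
    simp only [mul_assoc, toH_mul_mul, cr_comm v u, dt_comm v u, map_neg, neg_mul, sub_mul,
      smul_mul_assoc] at e e' ⊢
    linear_combination (norm := module) e + e'
  -- `B H H`
  · constructor <;> module
  -- `B H Q`
  · have e := congrArg (fun q => toH u * t * q) h.HBQ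
    simp only [mul_add, mul_sub, mul_smul_comm, ← mul_assoc] at e
    simp only [← mul_assoc] at e ⊢
    linear_combination (norm := module) -e
  -- `B Q Q`
  · have e1 := congrArg (fun q => cr u (pol q s t)) h.BQQ_J
    have e2 := congrArg (fun q => cr u (pol q s t)) h.BQQ_B
    have e3 := congrArg (fun q => cr u (pol q s t)) h.BQQ_P
    have e4 := congrArg (fun q => dt u (pol q s t)) h.BQQ_H
    have r1 := congrArg QuaternionAlgebra.re h.BQQ_J
    have r2 := congrArg QuaternionAlgebra.re h.BQQ_B
    have r3 := congrArg QuaternionAlgebra.re h.BQQ_P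
    have p1 := pol_twist h.c1_re u D.b s t
    have p2 := pol_twist h.c2_re u D.b s t
    have p3 := pol_twist h.c3_re u D.b s t
    simp only [pol_add_coeff, pol_sub_coeff, pol_neg_coeff, pol_smul_coeff, pol_one_coeff,
      cr_add_right, cr_smul_right, dt_smul_right, smul_zero, cr_zero_right, sub_zero,
      dt_neg_right, zero_add] at e1 e2 e3 e4
    simp only [Quaternion.re_smul, Quaternion.re_add, Quaternion.re_one, h.c1_re, h.c2_re,
      h.c3_re, smul_eq_mul, mul_zero, mul_one, add_zero] at r1 r2 r3
    refine ⟨?_, ?_, ?_, ?_⟩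
    · linear_combination (norm := module) p1 + e1 + nrm s t • (r1 • u)
    · linear_combination (norm := module) p2 + e2 + nrm s t • (r2 • u)
    · linear_combination (norm := module) p3 + e3 + nrm s t • (r3 • u)
    · linear_combination -D.c0 * nrm_twist u D.b s t - e4
  -- `P P P`
  · refine ⟨?_, ?_⟩
    · rw [cr_leibniz u v w]; module
    · have e1 : dt (cr u v) w = dt (cr v w) u := by rw [dt_comm (cr v w), dt_cr]
      have e2 : dt (cr u w) v = -dt (cr v w) u := by
        rw [cr_comm u w, dt_neg_left, dt_cr, dt_comm w, e1]
      rw [e1, e2]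
      linear_combination -3 * dt (cr v w) u * h.PPP_H
  -- `P P H`
  · rw [cr_comm v u]
    refine ⟨?_, ?_, ?_, ?_⟩
    · linear_combination (norm := module) -(2 : ℝ) • (h.HPP_J • cr u v)
    · linear_combination (norm := module) h.HPP_B • cr u v
    · linear_combination (norm := module) h.HPP_P • cr u v
    · rw [dt_comm]
  -- `P P Q`
  · have e := congrArg (fun q => toH (cr u v) * t * q) h.PPQ
    simp only [mul_add, mul_smul_comm, mul_one, ← mul_assoc] at e
    simp only [mul_assoc, toH_mul_mul, cr_comm v u, dt_comm v u, map_neg, neg_mul, sub_mul,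
      smul_mul_assoc] at e ⊢
    linear_combination (norm := module) e
  -- `P H H`
  · constructor <;> module
  -- `P H Q`
  · have e := congrArg (fun q => toH u * t * q) h.HPQ
    simp only [mul_add, mul_sub, mul_smul_comm, ← mul_assoc] at e
    simp only [← mul_assoc] at e ⊢
    linear_combination (norm := module) -e
  -- `P Q Q`
  · have e1 := congrArg (fun q => cr u (pol q s t)) h.PQQ_J
    have e2 := congrArg (fun q => cr u (pol q s t)) h.PQQ_B
    have e3 := congrArg (fun q => cr u (pol q s t)) h.PQQ_P
    have e4 := congrArg (fun q => dt u (pol q s t)) h.PQQ_H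
    have r1 := congrArg QuaternionAlgebra.re h.PQQ_J
    have r2 := congrArg QuaternionAlgebra.re h.PQQ_B
    have r3 := congrArg QuaternionAlgebra.re h.PQQ_P
    have p1 := pol_twist h.c1_re u D.p s t
    have p2 := pol_twist h.c2_re u D.p s t
    have p3 := pol_twist h.c3_re u D.p s t
    simp only [pol_add_coeff, pol_sub_coeff, pol_neg_coeff, pol_smul_coeff, pol_one_coeff,
      cr_add_right, cr_smul_right, dt_smul_right, smul_zero, cr_zero_right, sub_zero,
      dt_neg_right, zero_add] at e1 e2 e3 e4
    simp only [Quaternion.re_smul, Quaternion.re_add, Quaternion.re_one, h.c1_re, h.c2_re,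
      h.c3_re, smul_eq_mul, mul_zero, mul_one, add_zero] at r1 r2 r3
    refine ⟨?_, ?_, ?_, ?_⟩
    · linear_combination (norm := module) p1 + e1 + nrm s t • (r1 • u)
    · linear_combination (norm := module) p2 + e2 + nrm s t • (r2 • u)
    · linear_combination (norm := module) p3 + e3 + nrm s t • (r3 • u)
    · rw [dt_comm]
      linear_combination -D.c0 * nrm_twist u D.p s t - e4
  -- `H Q Q`
  · have e1 := congrArg (fun q => pol q s t) h.HQQ_J
    have e2 := congrArg (fun q => pol q s t) h.HQQ_B
    have e3 := congrArg (fun q => pol q s t) h.HQQ_P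
    simp only [← pol_mul_right, pol_add_coeff (_ • _), pol_smul_coeff, pol_zero_coeff] at e1 e2 e3
    refine ⟨?_, ?_, ?_, ?_⟩
    · linear_combination (norm := module) e1
    · linear_combination (norm := module) e2
    · linear_combination (norm := module) e3
    · linear_combination -D.c0 * nrm_mul_right D.h s t - 2 * nrm s t * h.HQQ_H
  -- `Q Q Q`
  · have e1 := pol_cyclic h.c1_re r s t
    have e2 := congrArg (· * D.b) (pol_cyclic h.c2_re r s t)
    have e3 := congrArg (· * D.p) (pol_cyclic h.c3_re r s t)
    have e4 := congrArg ((nrm s t • r + nrm r s • t + nrm t r • s) * ·) h.QQQ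
    simp only [pol_comm _ t r, nrm_comm t r, add_mul, mul_add, smul_mul_assoc, mul_smul_comm,
      mul_assoc] at e1 e2 e3 e4 ⊢
    linear_combination (norm := module) (1 / 2 : ℝ) • e1 + e2 + e3 - e4

theorem KinData.JacobiConditions.isLieSuperalgebra {D : KinData} (h : D.JacobiConditions) :
    IsLieSuperalgebra (kinAlgebra D) where
  isCompl := kinAlgebra_isCompl D
  bracket_mem := kinAlgebra_bracket_mem D
  skew := kinAlgebra_skew D
  jacobi := jacobi_of_generators h.genJacobi

set_option maxHeartbeats 4000000 in
theorem KinLabel.jacobiConditions (L : KinLabel) : L.data.JacobiConditions := by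
  cases L <;> constructor <;>
    simp only [KinLabel.data, K1, K2, K3, K4, K5, K6, K8, K11, K12, K13, K14, K15, K16, K17,
      K18] <;>
    first
    | norm_num; done
    | (ext <;> simp <;> ring1)

/-! ### The first cohomology and the invariants of rotations -/

section Invariants

variable {M Z : Type*} [AddCommGroup M] [Module ℝ M] [AddCommGroup Z] [Module ℝ Z]

/-- The standard basis of `ℝ³`. -/
abbrev e (a : Fin 3) : V3 := Pi.single a 1

theorem eq_sum_e (u : V3) : u = u 0 • e 0 + u 1 • e 1 + u 2 • e 2 := by
  apply vec_ext <;> simp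

theorem cr_e_zero (u : V3) : cr (e 0) u = u 1 • e 2 - u 2 • e 1 := by
  apply vec_ext <;> simp [cr_apply_zero, cr_apply_one, cr_apply_two]

theorem cr_e_one (u : V3) : cr (e 1) u = u 2 • e 0 - u 0 • e 2 := by
  apply vec_ext <;> simp [cr_apply_zero, cr_apply_one, cr_apply_two]

theorem cr_e_two (u : V3) : cr (e 2) u = u 0 • e 1 - u 1 • e 0 := by
  apply vec_ext <;> simp [cr_apply_zero, cr_apply_one, cr_apply_two]

/-- The identity behind Whitehead's first lemma for rotations: a 1-cocycle `f` with values in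
`Hom(M, Z)` becomes a coboundary after composition with the Casimir operator of `M`. -/
theorem cocycle_comp_casimir (ρ : V3 →ₗ[ℝ] M →ₗ[ℝ] M) (f : V3 →ₗ[ℝ] M →ₗ[ℝ] Z)
    (hρ : ∀ u v m, ρ u (ρ v m) = ρ (cr u v) m + ρ v (ρ u m))
    (hf : ∀ u v m, f u (ρ v m) = f (cr u v) m + f v (ρ u m)) (u : V3) (m : M) :
    ∑ a, f (e a) (ρ (e a) (ρ u m)) = f u (∑ a, ρ (e a) (ρ (e a) m)) := by
  have h : ∀ a, f (e a) (ρ (e a) (ρ u m))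
      = f u (ρ (e a) (ρ (e a) m)) + (f (e a) (ρ (cr (e a) u) m) + f (cr (e a) u) (ρ (e a) m)) := by
    intro a
    rw [hρ (e a) u, map_add, hf (e a) u]
    abel
  simp only [h, Fin.sum_univ_three, cr_e_zero, cr_e_one, cr_e_two, map_add, map_sub, map_smul,
    LinearMap.sub_apply, LinearMap.smul_apply]
  module

theorem eq_zero_of_eq_neg {z : Z} (h : z = -z) : z = 0 := by
  have h2 : (2 : ℝ) • z = 0 := by
    rw [two_smul]
    nth_rewrite 1 [h]
    exact neg_add_cancel z
  exact (smul_eq_zero.mp h2).resolve_left two_ne_zero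

/-- There is no invariant linear form on vectors. -/
theorem linear_eq_zero_of_cr (f : V3 →ₗ[ℝ] Z) (h : ∀ u v, f (cr u v) = 0) (u : V3) : f u = 0 := by
  have h0 := h (e 1) (e 2)
  have h1 := h (e 2) (e 0)
  have h2 := h (e 0) (e 1)
  rw [cr_e_one] at h0
  rw [cr_e_two] at h1
  rw [cr_e_zero] at h2
  simp at h0 h1 h2
  rw [eq_sum_e u]
  simp [h0, h1, h2]

/-- The invariant bilinear forms on vectors are the multiples of the scalar product. -/
theorem bilinear_eq_dt (g : V3 →ₗ[ℝ] V3 →ₗ[ℝ] Z)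
    (h : ∀ u v w, g (cr u v) w + g v (cr u w) = 0) (v w : V3) :
    g v w = dt v w • g (e 0) (e 0) := by
  have h01 := h (e 1) (e 2) (e 1)
  have h02 := h (e 2) (e 1) (e 2)
  have h10 := h (e 0) (e 2) (e 0)
  have h12 := h (e 2) (e 0) (e 2)
  have h20 := h (e 0) (e 1) (e 0)
  have h21 := h (e 1) (e 0) (e 1)
  have h11 := h (e 2) (e 0) (e 1)
  have h22 := h (e 1) (e 0) (e 2)
  simp [cr_e_zero, cr_e_one, cr_e_two] at h01 h02 h10 h12 h20 h21 h11 h22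
  have h11' : g (e 1) (e 1) = g (e 0) (e 0) := add_neg_eq_zero.mp h11
  have h22' : g (e 2) (e 2) = g (e 0) (e 0) := by
    rw [neg_add_eq_zero] at h22
    exact h22
  rw [eq_sum_e v, eq_sum_e w]
  simp only [map_add, map_smul, LinearMap.add_apply, LinearMap.smul_apply, h01, h02, h10, h12,
    h20, h21, h11', h22', dt_eq]
  simp
  module

/-- There is no invariant linear form on spinors. -/
theorem linear_eq_zero_of_toH_mul (f : ℍ[ℝ] →ₗ[ℝ] Z) (h : ∀ u s, f (toH u * s) = 0)
    (s : ℍ[ℝ]) : f s = 0 := by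
  have := h (e 0) (toH (e 0) * s)
  rw [toH_mul_mul] at this
  simpa [dt_eq] using this

/-- There is no invariant pairing of vectors and spinors: invariance at `(u, u, u s)` gives
`g(u, u² s) = 0`, and `u² = -|u|²`. -/
theorem bilinear_eq_zero (g : V3 →ₗ[ℝ] ℍ[ℝ] →ₗ[ℝ] Z)
    (h : ∀ u v s, g (cr u v) s + g v ((1 / 2 : ℝ) • (toH u * s)) = 0) (u : V3) (s : ℍ[ℝ]) :
    g u s = 0 := by
  have h1 := h u u (toH u * s)
  rw [toH_mul_mul, cr_self] at h1
  have h2 : dt u u = 0 ∨ g u s = 0 := by simpa using h1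
  rcases h2 with h2 | h2
  · have h3 : u = 0 := by
      rw [dt_eq] at h2
      apply vec_ext <;> simp only [Pi.zero_apply] <;> nlinarith [sq_nonneg (u 0), sq_nonneg (u 1),
        sq_nonneg (u 2)]
    simp [h3]
  · exact h2

/-- The symmetric invariant bilinear forms on spinors are the multiples of `Re(s̄ t)`: invariance
gives `g(s, t) = g(1, s̄ t)`, and symmetry kills `g(1, ·)` on imaginary quaternions. -/
theorem bilinear_eq_nrm (g : ℍ[ℝ] →ₗ[ℝ] ℍ[ℝ] →ₗ[ℝ] Z) (hs : ∀ s t, g s t = g t s)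
    (h : ∀ u s t, g (toH u * s) t + g s (toH u * t) = 0) (s t : ℍ[ℝ]) :
    g s t = nrm s t • g 1 1 := by
  have hq : ∀ q : ℍ[ℝ], q = q.re • 1 + toH (vec q) * 1 := fun q => by ext <;> simp
  have h1 : ∀ u, g 1 (toH u * 1) = 0 := fun u => by
    refine eq_zero_of_eq_neg ?_
    have := h u 1 1
    rw [hs (toH u * 1)] at this
    exact eq_neg_of_add_eq_zero_left this
  have h2 : ∀ q, g 1 q = q.re • g 1 1 := fun q => by
    conv_lhs => rw [hq q]
    rw [map_add, map_smul, h1, add_zero]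
  have h3 : g s t = g 1 (star s * t) := by
    have h4 : star s * t = s.re • t - toH (vec s) * t := by
      conv_lhs => rw [hq s]
      ext <;> simp <;> ring
    rw [h4, map_sub, map_smul, sub_eq_add_neg, ← eq_neg_of_add_eq_zero_left (h (vec s) 1 t)]
    conv_lhs => rw [hq s]
    simp
  rw [h3, h2]
  rfl

end Invariants

/-! ### The second cohomology of kinematical superalgebras -/

section Cocycles

variable {Z : Type*} [AddCommGroup Z] [Module ℝ Z] {C : SuperAlgebra Z} {D : KinData}
  {ω : KinSpace →ₗ[ℝ] KinSpace →ₗ[ℝ] Z}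

/-- The generators `J(u)`, as a linear map in `u`. -/
noncomputable def linJ : V3 →ₗ[ℝ] KinSpace := LinearMap.inl ℝ _ _ ∘ₗ LinearMap.inl ℝ _ _

/-- The generators `B(u)`, as a linear map in `u`. -/
noncomputable def linB : V3 →ₗ[ℝ] KinSpace :=
  LinearMap.inl ℝ _ _ ∘ₗ LinearMap.inr ℝ _ _ ∘ₗ LinearMap.inl ℝ _ _

/-- The generators `P(u)`, as a linear map in `u`. -/
noncomputable def linP : V3 →ₗ[ℝ] KinSpace :=
  LinearMap.inl ℝ _ _ ∘ₗ LinearMap.inr ℝ _ _ ∘ₗ LinearMap.inr ℝ _ _ ∘ₗ LinearMap.inl ℝ _ _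

/-- The generators `Q(s)`, as a linear map in `s`. -/
noncomputable def linQ : ℍ[ℝ] →ₗ[ℝ] KinSpace := LinearMap.inr ℝ _ _

theorem linB_apply (u : V3) : linB u = (Gen.B u).el := rfl
theorem linP_apply (u : V3) : linP u = (Gen.P u).el := rfl
theorem linQ_apply (s : ℍ[ℝ]) : linQ s = (Gen.Q s).el := rfl

theorem bracket_J (D : KinData) (u : V3) (X : KinSpace) :
    (kinAlgebra D).bracket (Gen.J u).el X
      = ((cr u X.1.1, cr u X.1.2.1, cr u X.1.2.2.1, 0), (1 / 2 : ℝ) • (toH u * X.2)) := by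
  obtain ⟨⟨ω, β, π, t⟩, s⟩ := X
  simp [kinAlgebra_bracket, kinBracketFun, Gen.el]

theorem bracket_J_J (D : KinData) (u v : V3) :
    (kinAlgebra D).bracket (Gen.J u).el (Gen.J v).el = (Gen.J (cr u v)).el := by
  rw [bracket_J]; simp [Gen.el]

theorem bracket_J_B (D : KinData) (u v : V3) :
    (kinAlgebra D).bracket (Gen.J u).el (Gen.B v).el = (Gen.B (cr u v)).el := by
  rw [bracket_J]; simp [Gen.el]

theorem bracket_J_P (D : KinData) (u v : V3) :
    (kinAlgebra D).bracket (Gen.J u).el (Gen.P v).el = (Gen.P (cr u v)).el := by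
  rw [bracket_J]; simp [Gen.el]

theorem bracket_J_H (D : KinData) (u : V3) :
    (kinAlgebra D).bracket (Gen.J u).el Gen.H.el = 0 := by
  rw [bracket_J]; simp [Gen.el]

theorem bracket_J_Q (D : KinData) (u : V3) (s : ℍ[ℝ]) :
    (kinAlgebra D).bracket (Gen.J u).el (Gen.Q s).el = (Gen.Q ((1 / 2 : ℝ) • (toH u * s))).el := by
  rw [bracket_J]; simp [Gen.el]

/-- The inverse of minus the Casimir operator of the rotations, and zero on the invariant `H`:
the Casimir operator is `-2` on vectors and `-3/4` on spinors. -/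
noncomputable def casimirInv : KinSpace →ₗ[ℝ] KinSpace where
  toFun X := (((1 / 2 : ℝ) • X.1.1, (1 / 2 : ℝ) • X.1.2.1, (1 / 2 : ℝ) • X.1.2.2.1, 0),
    (4 / 3 : ℝ) • X.2)
  map_add' X Y := by simp
  map_smul' r X := by simp [smul_comm r]

theorem bracket_J_casimirInv (D : KinData) (u : V3) (X : KinSpace) :
    (kinAlgebra D).bracket (Gen.J u).el (casimirInv X)
      = casimirInv ((kinAlgebra D).bracket (Gen.J u).el X) := by
  simp [bracket_J, casimirInv, cr_smul_right, smul_comm (4 / 3 : ℝ)]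

theorem sum_cr_cr (u : V3) : ∑ a, cr (e a) (cr (e a) u) = (-2 : ℝ) • u := by
  rw [Fin.sum_univ_three]
  apply vec_ext <;> simp [cr_apply_zero, cr_apply_one, cr_apply_two] <;> ring

theorem casimir_casimirInv (D : KinData) (X : KinSpace) :
    ∑ a, (kinAlgebra D).bracket (Gen.J (e a)).el
      ((kinAlgebra D).bracket (Gen.J (e a)).el (casimirInv X)) = -X + X.1.2.2.2 • Gen.H.el := by
  have h : ∀ v : V3, ∑ a, cr (e a) (cr (e a) ((1 / 2 : ℝ) • v)) = -v := fun v => by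
    rw [sum_cr_cr]; module
  have hq : ∀ s : ℍ[ℝ], ∑ a, (1 / 2 : ℝ) • (toH (e a) *
      ((1 / 2 : ℝ) • (toH (e a) * ((4 / 3 : ℝ) • s)))) = -s := fun s => by
    simp only [Fin.sum_univ_three, mul_smul_comm, toH_mul_mul, cr_self]
    simp [dt_eq]
    module
  obtain ⟨⟨ω, β, π, t⟩, s⟩ := X
  have h1 := h ω
  have h2 := h β
  have h3 := h π
  have h4 := hq s
  rw [Fin.sum_univ_three] at h1 h2 h3 h4 ⊢
  simp only [bracket_J, casimirInv, LinearMap.coe_mk, AddHom.coe_mk, Prod.mk_add_mk, h1, h2, h3, h4]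
  simp [Gen.el]

/-- Every cocycle is cohomologous to one which vanishes on rotations. -/
theorem IsCocycle.exists_coboundary_J (hω : IsCocycle (kinAlgebra D) C ω) :
    ∃ θ : KinSpace →ₗ[ℝ] Z, (∀ i, ∀ x ∈ (kinAlgebra D).part i, θ x ∈ C.part i) ∧
      ∀ u X, ω (Gen.J u).el X = θ ((kinAlgebra D).bracket (Gen.J u).el X) := by
  set ρ : V3 →ₗ[ℝ] KinSpace →ₗ[ℝ] KinSpace := (kinAlgebra D).bracket ∘ₗ linJ with hρ_def
  set f : V3 →ₗ[ℝ] KinSpace →ₗ[ℝ] Z := ω ∘ₗ linJ with hf_def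
  have hρa : ∀ u X, ρ u X = (kinAlgebra D).bracket (Gen.J u).el X := fun u X => rfl
  have hfa : ∀ u X, f u X = ω (Gen.J u).el X := fun u X => rfl
  have hf : ∀ u v X, f u (ρ v X) = f (cr u v) X + f v (ρ u X) := fun u v X => by
    have := hω.cocycle 0 0 _ ((Gen.J u).el_mem D) _ ((Gen.J v).el_mem D) X
    rwa [bracket_J_J, koszul_zero_left, one_smul] at this
  have hρ : ∀ u v X, ρ u (ρ v X) = ρ (cr u v) X + ρ v (ρ u X) := fun u v X => by
    simp only [hρa, bracket_J, Prod.mk_add_mk, ← cr_leibniz, add_zero, toH_cr]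
    congr 1
    simp only [mul_smul_comm, smul_mul_assoc, sub_mul, mul_assoc, smul_sub]
    module
  have hH : ∀ u, f u Gen.H.el = 0 := by
    refine linear_eq_zero_of_cr (f.flip Gen.H.el) fun u v => ?_
    have := hf u v Gen.H.el
    simp only [hρa, bracket_J_H, map_zero, add_zero] at this
    exact this.symm
  refine ⟨-((∑ a, f (e a) ∘ₗ ρ (e a)) ∘ₗ casimirInv), fun i x hx => ?_, fun u X => ?_⟩
  · have hx' : casimirInv x ∈ (kinAlgebra D).part i := by
      rcases zmod_two_cases i with rfl | rfl
      · rw [mem_kinAlgebra_part_zero] at hx ⊢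
        simp [casimirInv, hx]
      · rw [mem_kinAlgebra_part_one] at hx ⊢
        simp [casimirInv, hx]
    rw [LinearMap.neg_apply, LinearMap.comp_apply, LinearMap.sum_apply]
    refine neg_mem (sum_mem fun a _ => ?_)
    have h1 := kinAlgebra_bracket_mem D 0 i _ ((Gen.J (e a)).el_mem D) _ hx'
    have h2 := hω.mem 0 _ _ ((Gen.J (e a)).el_mem D) _ h1
    rwa [zero_add, zero_add] at h2
  · have h1 := cocycle_comp_casimir ρ f hρ hf u (casimirInv X)
    simp only [hρa, casimir_casimirInv, bracket_J_casimirInv D u, map_add, map_neg, map_smul, hH,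
      smul_zero, add_zero] at h1
    simp only [LinearMap.neg_apply, LinearMap.comp_apply, LinearMap.sum_apply, hρa]
    rw [h1, neg_neg]
    rfl

/-- A cocycle which vanishes on rotations is invariant under them, so it is determined by its
components on `B ⊗ P` and on `Q ⊗ Q`. -/
theorem IsCocycle.exists_eq_of_J (hω : IsCocycle (kinAlgebra D) C ω)
    (hJ : ∀ u X, ω (Gen.J u).el X = 0) :
    ∃ x ∈ C.part 0, ∃ y ∈ C.part 0, ∀ X Y, ω X Y =
      (dt X.1.2.1 Y.1.2.2.1 - dt Y.1.2.1 X.1.2.2.1) • x + nrm X.2 Y.2 • y := by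
  have hinv : ∀ u (y z : Gen), ω ((kinAlgebra D).bracket (Gen.J u).el y.el) z.el
      + ω y.el ((kinAlgebra D).bracket (Gen.J u).el z.el) = 0 := fun u y z => by
    have := hω.cocycle 0 _ _ ((Gen.J u).el_mem D) _ (y.el_mem D) z.el
    rw [hJ, koszul_zero_left, one_smul] at this
    exact this.symm
  have hsk : ∀ x y : Gen, ω x.el y.el = -(koszul x.par y.par • ω y.el x.el) := fun x y =>
    hω.skew _ _ _ (x.el_mem D) _ (y.el_mem D)
  have hskB : ∀ x y : Gen, x.par = 0 → ω y.el x.el = 0 → ω x.el y.el = 0 := fun x y hx h => by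
    rw [hsk, h, smul_zero, neg_zero]
  have hXJ : ∀ (x : Gen) u, ω x.el (Gen.J u).el = 0 := fun x u => by
    rw [hsk, hJ, smul_zero, neg_zero]
  have hBH : ∀ u, ω (Gen.B u).el Gen.H.el = 0 := by
    refine linear_eq_zero_of_cr (ω.flip Gen.H.el ∘ₗ linB) fun u v => ?_
    simpa [bracket_J_B, bracket_J_H, linB_apply] using hinv u (.B v) .H
  have hPH : ∀ u, ω (Gen.P u).el Gen.H.el = 0 := by
    refine linear_eq_zero_of_cr (ω.flip Gen.H.el ∘ₗ linP) fun u v => ?_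
    simpa [bracket_J_P, bracket_J_H, linP_apply] using hinv u (.P v) .H
  have hBQ : ∀ u s, ω (Gen.B u).el (Gen.Q s).el = 0 := by
    refine bilinear_eq_zero (ω.compl₁₂ linB linQ) fun u v s => ?_
    simpa only [bracket_J_B, bracket_J_Q, LinearMap.compl₁₂_apply, linB_apply, linQ_apply] using
      hinv u (.B v) (.Q s)
  have hPQ : ∀ u s, ω (Gen.P u).el (Gen.Q s).el = 0 := by
    refine bilinear_eq_zero (ω.compl₁₂ linP linQ) fun u v s => ?_
    simpa only [bracket_J_P, bracket_J_Q, LinearMap.compl₁₂_apply, linP_apply, linQ_apply] using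
      hinv u (.P v) (.Q s)
  have hHQ : ∀ s, ω Gen.H.el (Gen.Q s).el = 0 := by
    refine linear_eq_zero_of_toH_mul (ω Gen.H.el ∘ₗ linQ) fun u s => ?_
    have h1 : ω Gen.H.el (linQ ((1 / 2 : ℝ) • (toH u * s))) = 0 := by
      have h := hinv u .H (.Q s)
      rwa [bracket_J_Q, bracket_J_H, map_zero, LinearMap.zero_apply, zero_add] at h
    rw [map_smul, map_smul] at h1
    exact (smul_eq_zero.mp h1).resolve_left (by norm_num : (1 / 2 : ℝ) ≠ 0)
  have hHH : ω Gen.H.el Gen.H.el = 0 := eq_zero_of_eq_neg (by simpa [Gen.par] using hsk .H .H)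
  have hBB : ∀ u v, ω (Gen.B u).el (Gen.B v).el = 0 := by
    have h1 := bilinear_eq_dt (ω.compl₁₂ linB linB) fun u v w => by
      simpa only [bracket_J_B, LinearMap.compl₁₂_apply, linB_apply] using hinv u (.B v) (.B w)
    have h2 : ω (Gen.B (e 0)).el (Gen.B (e 0)).el = 0 :=
      eq_zero_of_eq_neg (by simpa [Gen.par] using hsk (.B (e 0)) (.B (e 0)))
    intro u v
    exact (h1 u v).trans (by simp [linB_apply, h2])
  have hPP : ∀ u v, ω (Gen.P u).el (Gen.P v).el = 0 := by
    have h1 := bilinear_eq_dt (ω.compl₁₂ linP linP) fun u v w => by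
      simpa only [bracket_J_P, LinearMap.compl₁₂_apply, linP_apply] using hinv u (.P v) (.P w)
    have h2 : ω (Gen.P (e 0)).el (Gen.P (e 0)).el = 0 :=
      eq_zero_of_eq_neg (by simpa [Gen.par] using hsk (.P (e 0)) (.P (e 0)))
    intro u v
    exact (h1 u v).trans (by simp [linP_apply, h2])
  have hBP : ∀ u v, ω (Gen.B u).el (Gen.P v).el = dt u v • ω (Gen.B (e 0)).el (Gen.P (e 0)).el :=
    bilinear_eq_dt (ω.compl₁₂ linB linP) fun u v w => by
      simpa only [bracket_J_B, bracket_J_P, LinearMap.compl₁₂_apply, linB_apply, linP_apply] using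
        hinv u (.B v) (.P w)
  have hPB : ∀ u v, ω (Gen.P u).el (Gen.B v).el
      = -(dt v u • ω (Gen.B (e 0)).el (Gen.P (e 0)).el) := fun u v => by
    rw [hsk, hBP]
    simp [Gen.par]
  have hQQ : ∀ s t, ω (Gen.Q s).el (Gen.Q t).el = nrm s t • ω (Gen.Q 1).el (Gen.Q 1).el := by
    refine bilinear_eq_nrm (ω.compl₁₂ linQ linQ) (fun s t => ?_) fun u s t => ?_
    · simpa [Gen.par, linQ_apply] using hsk (.Q s) (.Q t)
    · have h1 := hinv u (.Q s) (.Q t)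
      rw [bracket_J_Q, bracket_J_Q] at h1
      simp only [← linQ_apply, map_smul, LinearMap.smul_apply, ← smul_add] at h1
      exact (smul_eq_zero.mp h1).resolve_left (by norm_num : (1 / 2 : ℝ) ≠ 0)
  have hHB : ∀ u, ω Gen.H.el (Gen.B u).el = 0 := fun u => hskB .H (.B u) rfl (hBH u)
  have hHP : ∀ u, ω Gen.H.el (Gen.P u).el = 0 := fun u => hskB .H (.P u) rfl (hPH u)
  have hQB : ∀ s u, ω (Gen.Q s).el (Gen.B u).el = 0 := fun s u => by
    rw [hsk, hBQ, smul_zero, neg_zero]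
  have hQP : ∀ s u, ω (Gen.Q s).el (Gen.P u).el = 0 := fun s u => by
    rw [hsk, hPQ, smul_zero, neg_zero]
  have hQH : ∀ s, ω (Gen.Q s).el Gen.H.el = 0 := fun s => by
    rw [hsk, hHQ, smul_zero, neg_zero]
  refine ⟨ω (Gen.B (e 0)).el (Gen.P (e 0)).el,
    hω.mem 0 0 _ ((Gen.B (e 0)).el_mem D) _ ((Gen.P (e 0)).el_mem D),
    ω (Gen.Q 1).el (Gen.Q 1).el,
    hω.mem 1 1 _ ((Gen.Q 1).el_mem D) _ ((Gen.Q 1).el_mem D), fun X Y => ?_⟩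
  conv_lhs => rw [Gen.eq_sum X, Gen.eq_sum Y]
  simp only [map_add, map_smul, LinearMap.add_apply, LinearMap.smul_apply, hJ, hXJ, hBH, hPH, hBQ,
    hPQ, hHQ, hHH, hBB, hPP, hHB, hHP, hQB, hQP, hQH, smul_zero, add_zero, zero_add]
  rw [hBP X.1.2.1, hPB X.1.2.2.1, hQQ X.2]
  module

end Cocycles

section

variable {Z : Type*} [AddCommGroup Z] [Module ℝ Z] {C : SuperAlgebra Z} {D : KinData}
  {ω : KinSpace →ₗ[ℝ] KinSpace →ₗ[ℝ] Z} {x y : Z}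

/-- The cocycle conditions on the two components of an invariant 2-cochain. -/
theorem IsCocycle.constraints (hω : IsCocycle (kinAlgebra D) C ω) (h : ∀ X Y, ω X Y =
      (dt X.1.2.1 Y.1.2.2.1 - dt Y.1.2.1 X.1.2.2.1) • x + nrm X.2 Y.2 • y) :
    D.even.BB_B • x = 0 ∧ D.even.BB_P • x = 0 ∧ D.h.re • y = 0 ∧
      (∀ a, vec D.c3 a • x = (2 * vec D.b a) • y) ∧
      (∀ a, vec D.c2 a • x = -((2 * vec D.p a) • y)) := by
  have hc : ∀ X Y Z : Gen, _ := fun X Y Z =>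
    hω.cocycle _ _ _ (X.el_mem D) _ (Y.el_mem D) Z.el
  have cr01 : cr (e 0) (e 1) = e 2 := by simp [cr_e_zero]
  have cr12 : cr (e 1) (e 2) = e 0 := by simp [cr_e_one]
  have cr02 : cr (e 0) (e 2) = -e 1 := by simp [cr_e_zero]
  refine ⟨?_, ?_, ?_, fun a => ?_, fun a => ?_⟩
  -- each equation is the cocycle identity at one triple of generators
  · have h1 := hc (.B (e 0)) (.B (e 1)) (.P (e 2))
    simp [h, kinAlgebra_bracket, kinBracketFun, Gen.el, Gen.par, cr01, dt_eq] at h1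
    exact h1.symm
  · have h1 := hc (.B (e 0)) (.B (e 1)) (.B (e 2))
    simp [h, kinAlgebra_bracket, kinBracketFun, Gen.el, Gen.par, cr01, cr12, cr02, dt_eq] at h1
    have h2 : (3 : ℝ) • D.even.BB_P • x = 0 := by
      linear_combination (norm := module) h1
    exact (smul_eq_zero.mp h2).resolve_left (by norm_num)
  · have h1 := hc .H (.Q 1) (.Q 1)
    simp [h, kinAlgebra_bracket, kinBracketFun, Gen.el, Gen.par, dt_eq, nrm_eq] at h1
    have h2 : (2 : ℝ) • D.h.re • y = 0 := by
      linear_combination (norm := module) -h1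
    exact (smul_eq_zero.mp h2).resolve_left (by norm_num)
  · have h1 := hc (.B (e a)) (.Q 1) (.Q 1)
    fin_cases a <;>
      simp [h, kinAlgebra_bracket, kinBracketFun, Gen.el, Gen.par, dt_eq, nrm_eq, pol_apply_zero,
        pol_apply_one, pol_apply_two] at h1 ⊢ <;>
      linear_combination (norm := module) -h1
  · have h1 := hc (.P (e a)) (.Q 1) (.Q 1)
    fin_cases a <;>
      simp [h, kinAlgebra_bracket, kinBracketFun, Gen.el, Gen.par, dt_eq, nrm_eq, pol_apply_zero,
        pol_apply_one, pol_apply_two] at h1 ⊢ <;>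
      linear_combination (norm := module) h1

end

theorem kinCochain_apply (x y : ℝ) (X Y : KinSpace) : kinCochain x y X Y =
    x * (dt X.1.2.1 Y.1.2.2.1 - dt Y.1.2.1 X.1.2.2.1) + y * nrm X.2 Y.2 := rfl

/-- If the solutions of the cocycle conditions are, up to the coboundary of the functional dual to
`H`, the multiples of `(x₀, y₀)`, then `kinCochain x₀ y₀` spans the cocycles. -/
theorem cocyclesSpannedBy_kinCochain.{uZ} {D : KinData} (hD : IsLieSuperalgebra (kinAlgebra D))
    {x₀ y₀ : ℝ}
    (H : ∀ (Z : Type uZ) [AddCommGroup Z] [Module ℝ Z] (S : Submodule ℝ Z), ∀ x ∈ S, ∀ y ∈ S,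
      D.even.BB_B • x = 0 → D.even.BB_P • x = 0 → D.h.re • y = 0 →
      (∀ a, vec D.c3 a • x = (2 * vec D.b a) • y) →
      (∀ a, vec D.c2 a • x = -((2 * vec D.p a) • y)) →
      ∃ z ∈ S, ∃ c ∈ S, x = D.even.BP_H • z + x₀ • c ∧ y = D.c0 • z + y₀ • c) :
    CocyclesSpannedBy.{uZ} (kinAlgebra D) (kinCochain x₀ y₀) := by
  intro Z _ _ C ω hω
  obtain ⟨θ, hθ, hJ⟩ := hω.exists_coboundary_J
  have hω' := hω.sub_coboundary hD hθ
  obtain ⟨x, hx, y, hy, h⟩ := hω'.exists_eq_of_J fun u X => by simp [hJ]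
  obtain ⟨h1, h2, h3, h4, h5⟩ := hω'.constraints h
  obtain ⟨z, hz, c, hc, rfl, rfl⟩ := H Z (C.part 0) x hx y hy h1 h2 h3 h4 h5
  let η : KinSpace →ₗ[ℝ] Z := (LinearMap.toSpanSingleton ℝ Z z) ∘ₗ
    LinearMap.snd ℝ _ _ ∘ₗ LinearMap.snd ℝ _ _ ∘ₗ LinearMap.snd ℝ _ _ ∘ₗ LinearMap.fst ℝ _ _
  have hη : ∀ X, η X = X.1.2.2.2 • z := fun X => rfl
  refine ⟨θ + η, fun i X hX => add_mem (hθ i X hX) ?_, c, hc, fun X Y => ?_⟩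
  · rw [hη]
    rcases zmod_two_cases i with rfl | rfl
    · exact Submodule.smul_mem _ _ hz
    · rw [mem_kinAlgebra_part_one] at hX
      simp [hX]
  · have h6 := h X Y
    simp only [LinearMap.sub_apply, LinearMap.compr₂_apply] at h6
    rw [sub_eq_iff_eq_add] at h6
    rw [h6, LinearMap.add_apply, hη, kinCochain_apply]
    obtain ⟨⟨ω, β, π, t⟩, s⟩ := X
    obtain ⟨⟨ω', β', π', t'⟩, s'⟩ := Y
    simp only [kinAlgebra_bracket, kinBracketFun]
    module

/-! ### The table of central terms -/

/-- A row of the table of central terms adds `|s|² Z` to brackets of odd elements which do not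
involve `H`, in an algebra where `H` acts on odd elements by an imaginary quaternion and boosts
and translations act trivially; the remaining two rows are `S4` and `S13`. -/
theorem KinRow.cases {L : KinLabel} {x y : ℝ} (h : KinRow L x y) :
    (x = 0 ∧ y = 1 ∧ L.data.c0 = 0 ∧ L.data.h.re = 0 ∧ L.data.b = 0 ∧ L.data.p = 0) ∨
    (x = 1 ∧ y = 0 ∧ L.data = { even := K1, c0 := 1 }) ∨
    (x = 1 ∧ y = 0 ∧ L.data = { even := K6, c0 := 1 }) := by
  cases h <;> simp [KinLabel.data, *]

theorem isCocycle_kinCochain_of_re {D : KinData} (h : D.h.re = 0) (hb : D.b = 0) (hp : D.p = 0) :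
    IsCocycle (kinAlgebra D) line (kinCochain 0 1) where
  mem i j X hX Y hY := by
    rcases zmod_two_cases i with rfl | rfl <;> rcases zmod_two_cases j with rfl | rfl <;>
      simp only [mem_kinAlgebra_part_zero, mem_kinAlgebra_part_one] at hX hY <;>
      simp [line, kinCochain_apply, hX, hY, show (1 + 1 : ZMod 2) = 0 from rfl]
  skew i j X hX Y hY := by
    rcases zmod_two_cases i with rfl | rfl <;> rcases zmod_two_cases j with rfl | rfl <;>
      simp only [mem_kinAlgebra_part_zero, mem_kinAlgebra_part_one] at hX hY <;>
      simp [kinCochain_apply, hX, hY, nrm_comm X.2]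
  cocycle i j X hX Y hY Z := by
    obtain ⟨⟨ω, β, π, t⟩, s⟩ := X
    obtain ⟨⟨ω', β', π', t'⟩, s'⟩ := Y
    obtain ⟨⟨ω'', β'', π'', t''⟩, s''⟩ := Z
    rcases zmod_two_cases i with rfl | rfl <;> rcases zmod_two_cases j with rfl | rfl <;>
      simp only [mem_kinAlgebra_part_zero, mem_kinAlgebra_part_one, Prod.mk_eq_zero] at hX hY
    · subst hX hY
      simp [kinCochain_apply, kinAlgebra_bracket, kinBracketFun, hb, hp]
    · subst hX
      obtain ⟨rfl, rfl, rfl, rfl⟩ := hY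
      simp [kinCochain_apply, kinAlgebra_bracket, kinBracketFun, hb, hp, nrm_eq, h]
      ring
    · subst hY
      obtain ⟨rfl, rfl, rfl, rfl⟩ := hX
      simp [kinCochain_apply, kinAlgebra_bracket, kinBracketFun, hb, hp, nrm_eq, h]
      ring
    · obtain ⟨rfl, rfl, rfl, rfl⟩ := hX
      obtain ⟨rfl, rfl, rfl, rfl⟩ := hY
      simp [kinCochain_apply, kinAlgebra_bracket, kinBracketFun, hb, hp, nrm_eq, h]
      ring

/-- The form `ω(B, P)` is a cocycle when the only bracket of boosts or translations, apart from
those with rotations, is `[B, P] ∈ ℝ H`, and `H` is central. -/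
theorem isCocycle_kinCochain_of_heisenberg (f : ℝ) :
    IsCocycle (kinAlgebra { even := { BP_H := f }, c0 := 1 }) line (kinCochain 1 0) where
  mem i j X hX Y hY := by
    rcases zmod_two_cases i with rfl | rfl <;> rcases zmod_two_cases j with rfl | rfl <;>
      simp only [mem_kinAlgebra_part_zero, mem_kinAlgebra_part_one] at hX hY <;>
      simp [line, kinCochain_apply, hX, hY, show (1 + 1 : ZMod 2) = 0 from rfl]
  skew i j X hX Y hY := by
    rcases zmod_two_cases i with rfl | rfl <;> rcases zmod_two_cases j with rfl | rfl <;>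
      simp only [mem_kinAlgebra_part_zero, mem_kinAlgebra_part_one] at hX hY <;>
      simp [kinCochain_apply, hX, hY]
  cocycle i j X hX Y hY Z := by
    obtain ⟨⟨ω, β, π, t⟩, s⟩ := X
    obtain ⟨⟨ω', β', π', t'⟩, s'⟩ := Y
    obtain ⟨⟨ω'', β'', π'', t''⟩, s''⟩ := Z
    rcases zmod_two_cases i with rfl | rfl <;> rcases zmod_two_cases j with rfl | rfl <;>
      simp only [mem_kinAlgebra_part_zero, mem_kinAlgebra_part_one, Prod.mk_eq_zero] at hX hY
    · subst hX hY
      simp [kinCochain_apply, kinAlgebra_bracket, kinBracketFun, dt_eq, cr_apply_zero,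
        cr_apply_one, cr_apply_two]
      ring
    · obtain ⟨rfl, rfl, rfl, rfl⟩ := hY
      simp [kinCochain_apply, kinAlgebra_bracket, kinBracketFun]
    · obtain ⟨rfl, rfl, rfl, rfl⟩ := hX
      simp [kinCochain_apply, kinAlgebra_bracket, kinBracketFun]
    · obtain ⟨rfl, rfl, rfl, rfl⟩ := hX
      obtain ⟨rfl, rfl, rfl, rfl⟩ := hY
      simp [kinCochain_apply, kinAlgebra_bracket, kinBracketFun]

theorem KinRow.isCocycle {L : KinLabel} {x y : ℝ} (h : KinRow L x y) :
    IsCocycle L.algebra line (kinCochain x y) := by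
  rcases h.cases with ⟨rfl, rfl, -, h1, h2, h3⟩ | ⟨rfl, rfl, h1⟩ | ⟨rfl, rfl, h1⟩
  · exact isCocycle_kinCochain_of_re h1 h2 h3
  · rw [KinLabel.algebra, h1]
    exact isCocycle_kinCochain_of_heisenberg 0
  · rw [KinLabel.algebra, h1]
    exact isCocycle_kinCochain_of_heisenberg 1

/-- The 2-cycle is `∑ Q(s) ⊗ Q(s)`, with `s` in the standard basis of the quaternions, since
`∑ s c s̄ = 0` for imaginary `c`. -/
theorem nonzeroOnCycle_kinCochain_of_c0 {D : KinData} (h : D.c0 = 0) :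
    NonzeroOnCycle (kinAlgebra D) (kinCochain 0 1) := by
  refine ⟨4, ![(Gen.Q 1).el, (Gen.Q qi).el, (Gen.Q qj).el, (Gen.Q qk).el],
    ![(Gen.Q 1).el, (Gen.Q qi).el, (Gen.Q qj).el, (Gen.Q qk).el], ?_, ?_⟩
  · have hp : ∀ c, pol c 1 1 + pol c qi qi + pol c qj qj + pol c qk qk = 0 := fun c => by
      apply vec_ext <;> simp [pol_apply_zero, pol_apply_one, pol_apply_two] <;> ring
    simp only [Fin.sum_univ_four]
    simp [kinAlgebra_bracket, kinBracketFun, Gen.el, h, -neg_add_rev, ← neg_add, hp]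
  · simp only [Fin.sum_univ_four]
    simp [kinCochain_apply, Gen.el, nrm_eq]
    norm_num

theorem KinRow.nonzeroOnCycle {L : KinLabel} {x y : ℝ} (h : KinRow L x y) :
    NonzeroOnCycle L.algebra (kinCochain x y) := by
  rcases h.cases with ⟨rfl, rfl, h1, -⟩ | ⟨rfl, rfl, h1⟩ | ⟨rfl, rfl, h1⟩
  · exact nonzeroOnCycle_kinCochain_of_c0 h1
  · rw [KinLabel.algebra, h1]
    refine ⟨1, ![(Gen.B (e 0)).el], ![(Gen.P (e 0)).el], ?_, ?_⟩
    · simp [kinAlgebra_bracket, kinBracketFun, Gen.el, K1]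
    · simp [kinCochain_apply, Gen.el, dt_eq]
  · -- here `[B, P]` and `[Q, Q]` are both multiples of `H`, and only the former is seen by `ω`
    rw [KinLabel.algebra, h1]
    refine ⟨2, ![(Gen.B (e 0)).el, (Gen.Q 1).el], ![(Gen.P (e 0)).el, (Gen.Q (-1)).el], ?_, ?_⟩
    · simp [Fin.sum_univ_two, kinAlgebra_bracket, kinBracketFun, Gen.el, K6, dt_eq, nrm_eq]
    · simp [Fin.sum_univ_two, kinCochain_apply, Gen.el, dt_eq]

theorem KinRow.cocyclesSpannedBy.{uZ} {L : KinLabel} {x y : ℝ} (h : KinRow L x y) :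
    CocyclesSpannedBy.{uZ} L.algebra (kinCochain x y) := by
  refine cocyclesSpannedBy_kinCochain L.jacobiConditions.isLieSuperalgebra ?_
  intro Z _ _ S u hu v hv h1 h2 h3 h4 h5
  have h4k := h4 2
  have h5k := h5 2
  cases h
  case S4 => exact ⟨v, hv, u, hu, by simp [KinLabel.data, K1]⟩
  case S13 => exact ⟨v, hv, u - v, sub_mem hu hv, by simp [KinLabel.data, K6]⟩
  all_goals
    have hu0 : u = 0 := by
      first
      | simpa [KinLabel.data, K14] using h1
      | simpa [KinLabel.data, K15, K17] using h2
      | simpa [KinLabel.data] using h4k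
      | simpa [KinLabel.data] using h5k
    exact ⟨0, zero_mem _, v, hv, by simp [hu0, KinLabel.data]⟩

theorem KinLabel.cocyclesSpannedBy_zero.{uZ} {L : KinLabel} (h : ¬ ∃ x y, KinRow L x y) :
    CocyclesSpannedBy.{uZ} L.algebra 0 := by
  have h0 : (0 : KinSpace →ₗ[ℝ] KinSpace →ₗ[ℝ] ℝ) = kinCochain 0 0 := by
    ext <;> simp [kinCochain_apply]
  rw [h0]
  refine cocyclesSpannedBy_kinCochain L.jacobiConditions.isLieSuperalgebra ?_
  intro Z _ _ S x hx y hy h1 h2 h3 h4 h5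
  simp only [zero_smul, add_zero]
  suffices ∃ z ∈ S, x = L.data.even.BP_H • z ∧ y = L.data.c0 • z by
    obtain ⟨z, hz, h⟩ := this
    exact ⟨z, hz, 0, zero_mem _, h⟩
  have h4i := h4 0
  have h4k := h4 2
  have h5j := h5 1
  have h5k := h5 2
  cases L
  case S10 γ l hγ =>
    have hγ0 : γ ≠ 0 := fun h0 => h ⟨_, _, KinRow.S10 γ l hγ h0⟩
    have hx0 : x = 0 := by simpa [KinLabel.data] using h5k
    have hy0 : y = 0 := by simpa [KinLabel.data, hγ0] using h3
    exact ⟨0, zero_mem _, by simp [hx0], by simp [hy0]⟩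
  case S11 χ hχ =>
    have hχ0 : χ ≠ 0 := fun h0 => h ⟨_, _, KinRow.S11 χ hχ h0⟩
    have hx0 : x = 0 := by simpa [KinLabel.data] using h4k
    have hy0 : y = 0 := by simpa [KinLabel.data, hχ0] using h3
    exact ⟨0, zero_mem _, by simp [hx0], by simp [hy0]⟩
  case S14 => exact ⟨y, hy, by simpa [KinLabel.data, K8] using h4k, by simp [KinLabel.data]⟩
  case S15 => exact ⟨y, hy, by simpa [KinLabel.data, K11] using h4i, by simp [KinLabel.data]⟩
  all_goals try exact absurd ⟨_, _, by constructor⟩ h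
  all_goals
    have hx0 : x = 0 := by
      first
      | simpa [KinLabel.data, K12, K13, K14, K16] using h1
      | simpa [KinLabel.data, K15, K17, K18] using h2
      | simpa [KinLabel.data] using h4k
    first
    -- if `c₀ = 1`, the component on `Q ⊗ Q` is a coboundary
    | (refine ⟨y, hy, ?_, ?_⟩ <;> simp [hx0, KinLabel.data, K1, K12, K13, K14, K15]; done)
    | have hy0 : y = 0 := by
        first
        | simpa [KinLabel.data] using h3
        | simpa [KinLabel.data] using h5j
      exact ⟨0, zero_mem _, by simp [hx0], by simp [hy0]⟩

/-! ### Aristotelian superalgebras as retracts -/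

/-- The kinematical superalgebra which is the direct product of an aristotelian one with a copy
of `so(3)` spanned by the `B(β)`. The aristotelian factor has rotations `J(ω) - B(ω)`. -/
noncomputable def AriData.toKin (D : AriData) : KinData where
  even := { HP_P := D.HP_P, BB_B := 1, PP_J := D.PP_J, PP_B := -D.PP_J }
  h := D.h
  p := D.p
  c0 := D.c0
  c1 := D.c1
  c2 := -D.c1
  c3 := D.c3

/-- The inclusion of the aristotelian factor. -/
noncomputable def ariInclusion : AriSpace →ₗ[ℝ] KinSpace where
  toFun X := ((X.1.1, -X.1.1, X.1.2.1, X.1.2.2), X.2)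
  map_add' X Y := by simp [add_comm]; rfl
  map_smul' r X := by simp; rfl

/-- The projection to the aristotelian factor, with kernel spanned by the `B(β)`. -/
noncomputable def ariProjection : KinSpace →ₗ[ℝ] AriSpace where
  toFun X := ((X.1.1, X.1.2.2.1, X.1.2.2.2), X.2)
  map_add' _ _ := rfl
  map_smul' _ _ := rfl

theorem ariProjection_ariInclusion (X : AriSpace) : ariProjection (ariInclusion X) = X := rfl

theorem ariAlgebra_bracket (D : AriData) (X Y : AriSpace) :
    (ariAlgebra D).bracket X Y = ariBracketFun D X Y := rfl

theorem mem_ariAlgebra_part_zero {D : AriData} {X : AriSpace} :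
    X ∈ (ariAlgebra D).part 0 ↔ X.2 = 0 := by
  simp [ariAlgebra]

theorem mem_ariAlgebra_part_one {D : AriData} {X : AriSpace} :
    X ∈ (ariAlgebra D).part 1 ↔ X.1 = 0 := by
  simp [ariAlgebra]

theorem ariInclusion_mem_part {D : AriData} {i : ZMod 2} {X : AriSpace} :
    ariInclusion X ∈ (kinAlgebra D.toKin).part i ↔ X ∈ (ariAlgebra D).part i := by
  obtain ⟨⟨ω, π, t⟩, s⟩ := X
  rcases zmod_two_cases i with rfl | rfl
  · rw [mem_kinAlgebra_part_zero, mem_ariAlgebra_part_zero]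
    rfl
  · rw [mem_kinAlgebra_part_one, mem_ariAlgebra_part_one]
    simp only [ariInclusion, LinearMap.coe_mk, AddHom.coe_mk, Prod.mk_eq_zero, neg_eq_zero]
    tauto

theorem isHom_ariInclusion (D : AriData) :
    IsHom (ariAlgebra D) (kinAlgebra D.toKin) ariInclusion where
  map_part i x hx := ariInclusion_mem_part.mpr hx
  map_bracket x y := by
    obtain ⟨⟨ω, π, t⟩, s⟩ := x
    obtain ⟨⟨ω', π', t'⟩, s'⟩ := y
    simp only [ariAlgebra_bracket, kinAlgebra_bracket, ariBracketFun, kinBracketFun, ariInclusion,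
      AriData.toKin, LinearMap.coe_mk, AddHom.coe_mk, cr_neg_left, cr_neg_right, pol_neg_coeff,
      zero_smul, mul_zero, zero_mul, Prod.mk.injEq]
    refine ⟨⟨?_, ?_, ?_, ?_⟩, ?_⟩
    · module
    · module
    · module
    · ring
    · module

theorem isHom_ariProjection (D : AriData) :
    IsHom (kinAlgebra D.toKin) (ariAlgebra D) ariProjection where
  map_part i x hx := by
    obtain ⟨⟨ω, β, π, t⟩, s⟩ := x
    rcases zmod_two_cases i with rfl | rfl
    · rw [mem_kinAlgebra_part_zero] at hx
      rw [mem_ariAlgebra_part_zero]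
      exact hx
    · rw [mem_kinAlgebra_part_one] at hx
      rw [mem_ariAlgebra_part_one]
      simp only [Prod.mk_eq_zero] at hx
      simp [ariProjection, hx]
  map_bracket x y := by
    obtain ⟨⟨ω, β, π, t⟩, s⟩ := x
    obtain ⟨⟨ω', β', π', t'⟩, s'⟩ := y
    simp only [ariAlgebra_bracket, kinAlgebra_bracket, ariBracketFun, kinBracketFun, ariProjection,
      AriData.toKin, LinearMap.coe_mk, AddHom.coe_mk, zero_smul, mul_zero, zero_mul,
      Prod.mk.injEq]
    refine ⟨⟨?_, ?_, ?_⟩, ?_⟩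
    · module
    · module
    · ring
    · module

set_option maxHeartbeats 1000000 in
theorem AriLabel.jacobiConditions (L : AriLabel) : L.data.toKin.JacobiConditions := by
  cases L <;> constructor <;>
    simp only [AriLabel.data, AriData.toKin] <;>
    first
    | norm_num; done
    | (ext <;> simp <;> ring1)

theorem AriLabel.isLieSuperalgebra (L : AriLabel) : IsLieSuperalgebra L.algebra := by
  refine isLieSuperalgebra_of_injective L.jacobiConditions.isLieSuperalgebra
    (isHom_ariInclusion L.data) (Function.LeftInverse.injective ariProjection_ariInclusion)
    (fun i x => ariInclusion_mem_part.mp) ?_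
  constructor
  · rw [disjoint_iff, ← le_bot_iff]
    rintro X ⟨h0, h1⟩
    exact Prod.ext (mem_ariAlgebra_part_one.mp h1) (mem_ariAlgebra_part_zero.mp h0)
  · rw [codisjoint_iff, ← top_le_iff]
    rintro ⟨x, s⟩ -
    exact Submodule.mem_sup.mpr ⟨(x, 0), mem_ariAlgebra_part_zero.mpr rfl, (0, s),
      mem_ariAlgebra_part_one.mpr rfl, by simp⟩

theorem ariCochain_eq (y : ℝ) :
    ariCochain y = (kinCochain 0 y).compl₁₂ ariInclusion ariInclusion := by
  refine LinearMap.ext₂ fun X Y => ?_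
  simp only [LinearMap.compl₁₂_apply, kinCochain_apply, zero_mul, zero_add]
  rfl

theorem cocyclesSpannedBy_ariCochain.{uZ} (L : AriLabel) {y₀ : ℝ}
    (H : ∀ (Z : Type uZ) [AddCommGroup Z] [Module ℝ Z] (S : Submodule ℝ Z), ∀ y ∈ S,
      L.data.h.re • y = 0 → (∀ a, (2 * vec L.data.p a) • y = 0) →
      ∃ z ∈ S, ∃ c ∈ S, y = L.data.c0 • z + y₀ • c) :
    CocyclesSpannedBy.{uZ} L.algebra (ariCochain y₀) := by
  rw [ariCochain_eq]
  refine CocyclesSpannedBy.of_retract (cocyclesSpannedBy_kinCochain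
    L.jacobiConditions.isLieSuperalgebra ?_) (isHom_ariInclusion _) (isHom_ariProjection _)
    ariProjection_ariInclusion
  intro Z _ _ S x hx y hy h1 _ h3 _ h5
  have hx0 : x = 0 := by simpa [AriData.toKin] using h1
  subst hx0
  obtain ⟨z, hz, c, hc, h⟩ := H Z S y hy h3 fun a => by
    have h6 := h5 a
    rw [smul_zero, zero_eq_neg] at h6
    exact h6
  exact ⟨z, hz, c, hc, by simp [AriData.toKin], h⟩

theorem AriRow.cocyclesSpannedBy.{uZ} {L : AriLabel} {y : ℝ} (h : AriRow L y) :
    CocyclesSpannedBy.{uZ} L.algebra (ariCochain y) := by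
  refine cocyclesSpannedBy_ariCochain L fun Z _ _ S v hv _ _ => ⟨0, zero_mem _, v, hv, ?_⟩
  cases h <;> simp

theorem AriLabel.cocyclesSpannedBy_zero.{uZ} {L : AriLabel} (h : ¬ ∃ y, AriRow L y) :
    CocyclesSpannedBy.{uZ} L.algebra 0 := by
  have h0 : (0 : AriSpace →ₗ[ℝ] AriSpace →ₗ[ℝ] ℝ) = ariCochain 0 := by
    refine LinearMap.ext₂ fun X Y => ?_
    exact (zero_mul _).symm
  rw [h0]
  refine cocyclesSpannedBy_ariCochain L fun Z _ _ S y hy h1 h2 => ?_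
  have h2i := h2 0
  simp only [zero_smul, add_zero]
  suffices ∃ z ∈ S, y = L.data.c0 • z by
    obtain ⟨z, hz, h⟩ := this
    exact ⟨z, hz, 0, zero_mem _, h⟩
  cases L
  case S36 => exact absurd ⟨_, .S36⟩ h
  case S37 => exact absurd ⟨_, .S37⟩ h
  case S40 l => exact ⟨0, zero_mem _, by simpa [AriLabel.data] using h1⟩
  case S43 => exact ⟨0, zero_mem _, by simpa [AriLabel.data] using h2i⟩
  all_goals exact ⟨y, hy, by simp [AriLabel.data]⟩

theorem AriRow.isCocycle {L : AriLabel} {y : ℝ} (h : AriRow L y) :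
    IsCocycle L.algebra line (ariCochain y) := by
  have hc : IsCocycle (kinAlgebra L.data.toKin) line (kinCochain 0 y) := by
    cases h <;>
      exact isCocycle_kinCochain_of_re (by simp [AriData.toKin, AriLabel.data]) rfl rfl
  rw [ariCochain_eq]
  exact hc.comp (isHom_ariInclusion L.data)

theorem AriRow.nonzeroOnCycle {L : AriLabel} {y : ℝ} (h : AriRow L y) :
    NonzeroOnCycle L.algebra (ariCochain y) := by
  have hc : NonzeroOnCycle (kinAlgebra L.data.toKin) (kinCochain 0 y) := by
    cases h <;> exact nonzeroOnCycle_kinCochain_of_c0 rfl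
  obtain ⟨n, X, Y, h0, h1⟩ := hc
  have hXY : ∀ X Y, kinCochain 0 y X Y = ariCochain y (ariProjection X) (ariProjection Y) :=
    fun X Y => by
      rw [kinCochain_apply, zero_mul, zero_add]
      rfl
  simp only [hXY] at h1
  refine ⟨n, fun i => ariProjection (X i), fun i => ariProjection (Y i), ?_, h1⟩
  have h2 := congrArg ariProjection h0
  rw [map_sum, map_zero] at h2
  rw [← h2]
  exact Finset.sum_congr rfl fun i _ => ((isHom_ariProjection L.data).map_bracket _ _).symm

theorem HasCentralTerm.admitsNontrivial.{uZ, uW} {V : Type} [AddCommGroup V] [Module ℝ V]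
    {A : SuperAlgebra V} {ω : V →ₗ[ℝ] V →ₗ[ℝ] ℝ} (h : HasCentralTerm.{uZ, uW} A ω) :
    AdmitsNontrivialCentralExtension A :=
  ⟨ℝ, _, _, V × ℝ, _, _, _, _, _, _, h.1, h.2.1⟩

theorem OnlyTrivialCentralExtensions.not_admitsNontrivial {V : Type} [AddCommGroup V] [Module ℝ V]
    {A : SuperAlgebra V} (h : OnlyTrivialCentralExtensions.{0, 0} A) :
    ¬ AdmitsNontrivialCentralExtension A := by
  rintro ⟨Z, _, _, W, _, _, C, E, ι, π, h1, h2⟩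
  exact h2 (h Z W C E ι π h1)

theorem KinRow.hasCentralTerm.{uZ, uW} {L : KinLabel} {x y : ℝ} (h : KinRow L x y) :
    HasCentralTerm.{uZ, uW} L.algebra (kinCochain x y) :=
  hasCentralTerm_of_cocyclesSpannedBy L.jacobiConditions.isLieSuperalgebra h.isCocycle
    h.cocyclesSpannedBy h.nonzeroOnCycle

theorem AriRow.hasCentralTerm.{uZ, uW} {L : AriLabel} {y : ℝ} (h : AriRow L y) :
    HasCentralTerm.{uZ, uW} L.algebra (ariCochain y) :=
  hasCentralTerm_of_cocyclesSpannedBy L.isLieSuperalgebra h.isCocycle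
    h.cocyclesSpannedBy h.nonzeroOnCycle

end KLSA

theorem mainTheorem4 :
    ((∀ L : KinLabel, IsLieSuperalgebra L.algebra) ∧
      (∀ L : KinLabel, AdmitsNontrivialCentralExtension L.algebra ↔ ∃ x y, KinRow L x y) ∧
      (∀ L : KinLabel, (¬ ∃ x y, KinRow L x y) →
        OnlyTrivialCentralExtensions.{u, v} L.algebra) ∧
      (∀ (L : KinLabel) (x y : ℝ), KinRow L x y →
        HasCentralTerm.{u, v} L.algebra (kinCochain x y))) ∧
    ((∀ L : AriLabel, IsLieSuperalgebra L.algebra) ∧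
      (∀ L : AriLabel, AdmitsNontrivialCentralExtension L.algebra ↔ ∃ y, AriRow L y) ∧
      (∀ L : AriLabel, (¬ ∃ y, AriRow L y) →
        OnlyTrivialCentralExtensions.{u, v} L.algebra) ∧
      (∀ (L : AriLabel) (y : ℝ), AriRow L y →
        HasCentralTerm.{u, v} L.algebra (ariCochain y))) := by
  refine ⟨⟨fun L => L.jacobiConditions.isLieSuperalgebra, fun L => ⟨fun hL => ?_, ?_⟩,
      fun L hL => onlyTrivialCentralExtensions_of_cocyclesSpannedBy_zero
        (KinLabel.cocyclesSpannedBy_zero hL), fun L x y h => h.hasCentralTerm⟩,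
    ⟨fun L => L.isLieSuperalgebra, fun L => ⟨fun hL => ?_, ?_⟩,
      fun L hL => onlyTrivialCentralExtensions_of_cocyclesSpannedBy_zero
        (AriLabel.cocyclesSpannedBy_zero hL), fun L y h => h.hasCentralTerm⟩⟩
  · by_contra h
    exact (onlyTrivialCentralExtensions_of_cocyclesSpannedBy_zero
      (KinLabel.cocyclesSpannedBy_zero h)).not_admitsNontrivial hL
  · rintro ⟨x, y, h⟩
    exact (KinRow.hasCentralTerm.{0, 0} h).admitsNontrivial
  · by_contra h
    exact (onlyTrivialCentralExtensions_of_cocyclesSpannedBy_zero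
      (AriLabel.cocyclesSpannedBy_zero h)).not_admitsNontrivial hL
  · rintro ⟨y, h⟩
    exact (AriRow.hasCentralTerm.{0, 0} h).admitsNontrivial
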